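/- **Setting.** Let $n\ge 1$, let $\mathfrak g$ be the complex simple Lie algebra of type $B_n$ with Cartan subalgebra $\mathfrak h$, simple roots $\alpha_i=e_i-e_{i+1}$ ($1\le i<n$), $\alpha_n=e_n$, and $\mathfrak n_+$ the sum of the positive root spaces. The positive roots are indexed by the pairs $(r,s)$ with $1\le r\le s\le 2n-r$: $(r,s)$ is the root whose first nonzero coefficient in the basis of simple roots is that of $\alpha_r$ and whose height is $s-r+1$. Let $\tilde{\mathfrak g}=(\mathfrak g\otimes\mathbb C[t,t^{-1}])\oplus\mathbb Cc\oplus\mathbb Cd$ be the untwisted affine Lie algebra of type $\tilde B_n$, with $c$ central, $[x\otimes t^k,y\otimes t^l]=[x,y]\otimes t^{k+l}+k\,\delta_{k+l,0}(x|y)c$ for the Killing form $(\cdot|\cdot)$, and $[d,x\otimes t^k]=k\,x\otimes t^k$. Put $\tilde{\mathfrak h}=(\mathfrak h\otimes 1)\oplus\mathbb Cc\oplus\mathbb Cd$, $\tilde{\mathfrak n}_+=(\mathfrak n_+\otimes 1)\oplus\bigoplus_{k>0}\mathfrak g\otimes t^k$, $\tilde{\mathfrak b}=\tilde{\mathfrak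 h}\oplus\tilde{\mathfrak n}_+$. Let $\delta\in\tilde{\mathfrak h}^*$ be $1$ on $d$ and $0$ on $c$ and $\mathfrak h$, let $D_2$ be the set of the positive roots $(r,s)$ of $B_n$ (extended by $0$ to $c,d$), $D_3=\{\delta-(r,s)\}$ and $D=\{\delta\}\cup D_2\cup D_3$. A *basic ideal* is an ideal $\mathfrak i$ of $\tilde{\mathfrak b}$, contained in $\tilde{\mathfrak n}_+$ and of finite codimension, such that $\mathfrak i\cap\tilde{\mathfrak g}_\alpha\in\{0,\tilde{\mathfrak g}_\alpha\}$ for each positive root $\alpha$ of $\tilde{\mathfrak g}$, and whose support $\operatorname{supp}(\mathfrak i)$, the set of positive roots $\alpha$ with $\tilde{\mathfrak g}_\alpha\subset\mathfrak i$, meets $D$. A *$B_n$-path* is a word of length $2n$ in the letters $r,f$ each prefix of which contains at least as many $r$'s as $f$'s. $\mathfrak B_n(i,j)$ is the set of $B_n$-paths whose first and second $f$ are at the positions $i<j$, where missing $f$'s are thought of as following the word immediately (so a path whose only $f$ is at position $k$ lies in $\mathfrak B_n(k,2n+1)$, and $\mathfrak B_n(2n+1,2n+2)=\{rr\cdots r\}$).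 Represent $(r,s)\in D_2$ by the unit box with northwest corner $(s-1,1-r)$ in $\mathbb R^2$, and $\delta-(r,s)\in D_3$ by the unit box with northwest corner $(2n-s-1,r+1)$. A pair $(p,q)$ of $B_n$-paths is *admissible* if there is a basic ideal $\mathfrak i$ such that (1) the lattice path which starts at $(-1,0)$ and, reading $p$, goes one step right for each $r$ and one step down for each $f$, has to its northeast exactly the boxes of $D_2\cap\operatorname{supp}(\mathfrak i)$ among those of $D_2$; and (2) the lattice path which starts at $(2n,1)$ and, reading $q$, goes one step left for each $r$ and one step up for each $f$, has to its northeast exactly the boxes of $D_3\cap\operatorname{supp}(\mathfrak i)$ among those of $D_3$. **Proposition.** Let $p\in\mathfrak B_n(a,b)$ with $3\le a<b\le 2n$. Then $(p,q)$ is an admissible pair if and only if $q\in\mathfrak B_n(i,j)$ for some $i\ge 2n+4-b$ and $j\ge 2n+4-a$. Consequently, the number of $q$ such that $(p,q)$ is admissible is $$\sum_{i\ge 2n+4-b}\ \sum_{j\ge 2n+4-a}|\mathfrak B_n(i,j)|,$$ where only terms with $i<j\le 2n+2$ can be nonzero. -/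

import Mathlib

open scoped TensorProduct

noncomputable section

namespace AffineB

/-! ### The simple Lie algebra of type `B_n` -/

/-- The complex simple Lie algebra of type `B_n`: the orthogonal Lie algebra of rank `n` in
`2 n + 1` dimensions, realised by matrices indexed by `Unit ⊕ Fin n ⊕ Fin n`. -/
abbrev G (n : ℕ) : Type := ↥(LieAlgebra.Orthogonal.typeB (Fin n) ℂ)

/-- The Cartan subalgebra `𝔥` of diagonal matrices,
`diag(0, x_1, …, x_n, -x_1, …, -x_n)`. -/
def cartan (n : ℕ) : Submodule ℂ (G n) where
  carrier := {x | (x : Matrix (Unit ⊕ Fin n ⊕ Fin n) (Unit ⊕ Fin n ⊕ Fin n) ℂ).IsDiag}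
  add_mem' hx hy := hx.add hy
  zero_mem' := Matrix.isDiag_zero
  smul_mem' c _ hx := hx.smul c

/-- The functional `e_i`, `1 ≤ i ≤ n`, which on `𝔥` is `diag(0, x, -x) ↦ x_i`; by convention
`e_i = 0` for any other `i`. It is written as a functional on all of `𝔤`, but only its
restriction to `𝔥` is ever used. -/
def eps (n i : ℕ) : G n →ₗ[ℂ] ℂ :=
  if h : 1 ≤ i ∧ i ≤ n then
    { toFun := fun x => x.1 (Sum.inr (Sum.inl ⟨i - 1, by omega⟩)) (Sum.inr (Sum.inl ⟨i - 1, by omega⟩))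
      map_add' := fun _ _ => rfl
      map_smul' := fun _ _ => rfl }
  else 0

/-- The simple roots: `α_i = e_i - e_{i+1}` for `1 ≤ i < n`, and `α_n = e_n` (as `e_{n+1} = 0`). -/
def simpleRoot (n i : ℕ) : G n →ₗ[ℂ] ℂ := eps n i - eps n (i + 1)

/-- The index pairs `(r, s)` of the positive roots of `B_n`. -/
def IsRootIndex (n r s : ℕ) : Prop := 1 ≤ r ∧ r ≤ s ∧ r + s ≤ 2 * n

/-- The positive root `(r, s)` of `B_n`: the root whose first nonzero coefficient in the basis of
simple roots is that of `α_r`, and whose height is `s - r + 1`. For `s ≤ n` it is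
`α_r + ⋯ + α_s`, and for `s = 2 n - k > n` it is
`α_r + ⋯ + α_k + 2 α_{k+1} + ⋯ + 2 α_n`. -/
def posRoot (n r s : ℕ) : G n →ₗ[ℂ] ℂ :=
  ∑ i ∈ Finset.Icc r (min s n), simpleRoot n i +
    ∑ i ∈ Finset.Icc (2 * n + 1 - s) n, simpleRoot n i

/-- The root space `𝔤_γ = {x | [h, x] = γ(h) x for all h ∈ 𝔥}`. -/
def finRootSpace (n : ℕ) (γ : G n →ₗ[ℂ] ℂ) : Submodule ℂ (G n) where
  carrier := {x | ∀ h ∈ cartan n, ⁅h, x⁆ = γ h • x}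
  add_mem' hx hy h hh := by rw [lie_add, hx h hh, hy h hh, smul_add]
  zero_mem' h _ := by simp
  smul_mem' c x hx h hh := by rw [lie_smul, hx h hh, smul_comm]

/-- `𝔫₊`, the sum of the root spaces of the positive roots of `B_n`. -/
def nPlus (n : ℕ) : Submodule ℂ (G n) :=
  ⨆ (r : ℕ) (s : ℕ) (_ : IsRootIndex n r s), finRootSpace n (posRoot n r s)

/-! ### The untwisted affine Lie algebra of type `B̃_n` -/

/-- The loop algebra `ℂ[t, t⁻¹] ⊗ 𝔤`. -/
abbrev Loop (n : ℕ) : Type := LieAlgebra.loopAlgebra ℂ ℤ (G n)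

lemma neg_killingForm_lieInvariant (n : ℕ) :
    LinearMap.BilinForm.lieInvariant (G n) (-killingForm ℂ (G n)) := fun x y z => by
  simpa using congrArg Neg.neg (LieModule.traceForm_lieInvariant ℂ (G n) (G n) x y z)

lemma neg_killingForm_isSymm (n : ℕ) : (-killingForm ℂ (G n)).IsSymm :=
  ⟨fun x y => by simpa using LieModule.traceForm_comm ℂ (G n) (G n) x y⟩

/-- The 2-cocycle `(x ⊗ t^k, y ⊗ t^l) ↦ k (x | y) δ_{k + l, 0}`, with `( | )` the Killing form.
(Mathlib's cocycle attached to a form `Φ` is `l Φ(x, y) δ_{k + l, 0}`, whence the sign.) -/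
def cocycle (n : ℕ) : LieModule.Cohomology.twoCocycle ℂ (Loop n)
    (TrivialLieModule ℂ (Loop n) ℂ) :=
  LieAlgebra.LoopAlgebra.twoCocycleOfBilinear ℂ ℤ (G n) (-killingForm ℂ (G n))
    (neg_killingForm_lieInvariant n) (neg_killingForm_isSymm n)

lemma cocycle_tmul (n : ℕ) (k l : ℤ) (x y : G n) :
    (cocycle n).1 ((AddMonoidAlgebra.single k 1 : AddMonoidAlgebra ℂ ℤ) ⊗ₜ[ℂ] x)
        ((AddMonoidAlgebra.single l 1 : AddMonoidAlgebra ℂ ℤ) ⊗ₜ[ℂ] y) =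
      (TrivialLieModule.equiv ℂ (Loop n) ℂ).symm
        (if k + l = 0 then (k : ℂ) * killingForm ℂ (G n) x y else 0) := by
  simp only [cocycle, LieAlgebra.LoopAlgebra.twoCocycleOfBilinear_coe,
    LieAlgebra.LoopAlgebra.twoCochainOfBilinear_apply_apply,
    LieAlgebra.LoopAlgebra.residuePairing_apply_apply,
    LieAlgebra.LoopAlgebra.toFinsupp_single_tmul]
  rw [Finsupp.sum_single_index (by simp)]
  split_ifs with h
  · obtain rfl : l = -k := by omega
    simp
  · rw [Finsupp.single_eq_of_ne (by omega)]
    simp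

/-- The central extension `(ℂ[t, t⁻¹] ⊗ 𝔤) ⊕ ℂ c`. -/
abbrev Central (n : ℕ) : Type := LieAlgebra.ofTwoCocycle (cocycle n)

/-- The linear map `x ⊗ t^k ↦ k (x ⊗ t^k)` of the loop algebra. -/
def loopDegree (n : ℕ) : Loop n →ₗ[ℂ] Loop n :=
  LinearMap.rTensor (G n) ((AddMonoidAlgebra.basis ℤ ℂ).constr ℂ
    (fun k : ℤ => (k : ℂ) • (AddMonoidAlgebra.single k 1 : AddMonoidAlgebra ℂ ℤ)))

lemma loopDegree_tmul (n : ℕ) (k : ℤ) (x : G n) :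
    loopDegree n (AddMonoidAlgebra.single k 1 ⊗ₜ x) =
      (k : ℂ) • ((AddMonoidAlgebra.single k 1 : AddMonoidAlgebra ℂ ℤ) ⊗ₜ[ℂ] x) := by
  simp only [loopDegree, LinearMap.rTensor_tmul, TensorProduct.smul_tmul']
  rw [← AddMonoidAlgebra.basis_apply, Module.Basis.constr_basis, AddMonoidAlgebra.basis_apply]

lemma loop_induction {n : ℕ} {P : Loop n → Prop} (x : Loop n)
    (add : ∀ x y, P x → P y → P (x + y))
    (tmul : ∀ (k : ℤ) (x : G n), P ((AddMonoidAlgebra.single k 1 : AddMonoidAlgebra ℂ ℤ) ⊗ₜ[ℂ] x)) :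
    P x := by
  rw [← (LieAlgebra.LoopAlgebra.toFinsupp ℂ ℤ (G n)).symm_apply_apply x]
  induction LieAlgebra.LoopAlgebra.toFinsupp ℂ ℤ (G n) x using Finsupp.induction_linear with
  | zero => simpa using tmul 0 0
  | add f g hf hg => rw [map_add]; exact add _ _ hf hg
  | single k x => rw [LieAlgebra.LoopAlgebra.toFinsupp_symm_single]; exact tmul k x

lemma loopDegree_lie (n : ℕ) (x y : Loop n) :
    loopDegree n ⁅x, y⁆ = ⁅x, loopDegree n y⁆ - ⁅y, loopDegree n x⁆ := by
  have hskew : ⁅y, loopDegree n x⁆ = -⁅loopDegree n x, y⁆ := (lie_skew y (loopDegree n x)).symm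
  rw [hskew, sub_neg_eq_add]
  clear hskew
  induction x using loop_induction with
  | add x x' hx hx' =>
    have h1 (z : Loop n) : ⁅x + x', z⁆ = ⁅x, z⁆ + ⁅x', z⁆ := add_lie x x' z
    have h2 : ⁅loopDegree n x + loopDegree n x', y⁆ = ⁅loopDegree n x, y⁆ + ⁅loopDegree n x', y⁆ :=
      add_lie _ _ y
    rw [h1, h1, map_add, map_add, h2, hx, hx']; abel
  | tmul k x =>
    induction y using loop_induction with
    | add y y' hy hy' =>
      have h1 (z : Loop n) : ⁅z, y + y'⁆ = ⁅z, y⁆ + ⁅z, y'⁆ := lie_add z y y'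
      have h2 (z : Loop n) : ⁅z, loopDegree n y + loopDegree n y'⁆ =
        ⁅z, loopDegree n y⁆ + ⁅z, loopDegree n y'⁆ := lie_add z _ _
      rw [h1, h1, map_add, map_add, h2, hy, hy']; abel
    | tmul l y =>
      have h1 (a : ℂ) (z w : Loop n) : ⁅z, a • w⁆ = a • ⁅z, w⁆ := lie_smul a z w
      have h2 (a : ℂ) (z w : Loop n) : ⁅a • z, w⁆ = a • ⁅z, w⁆ := smul_lie a z w
      simp only [loopDegree_tmul, LieAlgebra.ExtendScalars.bracket_tmul,
        AddMonoidAlgebra.single_mul_single, mul_one, h1, h2, ← add_smul]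
      push_cast
      rw [add_comm (k : ℂ)]

lemma cocycle_loopDegree (n : ℕ) (x y : Loop n) :
    (cocycle n).1 x (loopDegree n y) - (cocycle n).1 y (loopDegree n x) = 0 := by
  rw [← LieModule.Cohomology.twoCochain_skew (cocycle n).1 (loopDegree n x) y, sub_neg_eq_add]
  induction x using loop_induction with
  | add x x' hx hx' =>
    simp only [map_add, LinearMap.add_apply]
    rw [add_add_add_comm, hx, hx', add_zero]
  | tmul k x =>
    induction y using loop_induction with
    | add y y' hy hy' =>
      simp only [map_add]
      rw [add_add_add_comm, hy, hy', add_zero]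
    | tmul l y =>
      simp only [loopDegree_tmul, map_smul, LinearMap.smul_apply, ← add_smul]
      by_cases hkl : l + k = 0
      · rw [show (l : ℂ) + (k : ℂ) = 0 by exact_mod_cast hkl, zero_smul]
      · rw [cocycle_tmul, if_neg (by omega), map_zero, smul_zero]

/-- The degree derivation of the central extension:
`x ⊗ t^k ↦ k (x ⊗ t^k)` and `c ↦ 0`. -/
def degree (n : ℕ) : LieDerivation ℂ (Central n) (Central n) where
  toFun z := LieAlgebra.ofProd (cocycle n)
    (loopDegree n ((LieAlgebra.ofProd (cocycle n)).symm z).1, 0)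
  map_add' x y := by
    rw [← LieAlgebra.of_add]; simp
  map_smul' a x := by
    simp [← LieAlgebra.of_smul]
  leibniz' x y := by
    have h (z w : Central n) : z - w = LieAlgebra.ofProd (cocycle n)
        ((LieAlgebra.ofProd (cocycle n)).symm z - (LieAlgebra.ofProd (cocycle n)).symm w) := rfl
    rw [h]
    simp only [LinearMap.coe_mk, AddHom.coe_mk, LieAlgebra.bracket_ofTwoCocycle,
      Equiv.symm_apply_apply]
    refine congrArg _ (Prod.ext ?_ ?_)
    · exact loopDegree_lie n _ _
    · simpa [LieModule.IsTrivial.trivial] using (cocycle_loopDegree n _ _).symm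

attribute [local instance 100] LieRing.ofAssociativeRing

/-- The action of the one-dimensional Lie algebra `ℂ d`, with `d` acting as the degree
derivation. -/
def degreeAction (n : ℕ) : ℂ →ₗ⁅ℂ⁆ LieDerivation ℂ (Central n) (Central n) where
  toFun a := a • degree n
  map_add' a b := add_smul a b _
  map_smul' a b := by simp [mul_smul]
  map_lie' {a b} := by simp [LieRing.of_associative_ring_bracket, mul_comm]

/-- The untwisted affine Kac–Moody algebra `𝔤̃ = (ℂ[t, t⁻¹] ⊗ 𝔤) ⊕ ℂ c ⊕ ℂ d`. -/
abbrev GAff (n : ℕ) : Type := LieAlgebra.SemiDirectSum (Central n) ℂ (degreeAction n)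

/-- The element `x ⊗ t^k`. -/
def mono (n : ℕ) (x : G n) (k : ℤ) : GAff n :=
  ⟨LieAlgebra.ofProd (cocycle n) ((AddMonoidAlgebra.single k 1 : AddMonoidAlgebra ℂ ℤ) ⊗ₜ[ℂ] x, 0), 0⟩

/-- The central element `c`. -/
def cElt (n : ℕ) : GAff n :=
  ⟨LieAlgebra.ofProd (cocycle n) (0, (TrivialLieModule.equiv ℂ (Loop n) ℂ).symm 1), 0⟩

/-- The derivation `d`. -/
def dElt (n : ℕ) : GAff n := ⟨0, 1⟩

/-- `𝔥̃`, the span of `c`, `d` and the `h ⊗ 1` with `h ∈ 𝔥`. -/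
def cartanAff (n : ℕ) : Submodule ℂ (GAff n) :=
  Submodule.span ℂ ({cElt n, dElt n} ∪ {z | ∃ h ∈ cartan n, z = mono n h 0})

/-- `𝔫̃₊`, the span of the `x ⊗ 1` with `x ∈ 𝔫₊` and the `x ⊗ t^k` with `x ∈ 𝔤`, `k > 0`. -/
def nPlusAff (n : ℕ) : Submodule ℂ (GAff n) :=
  Submodule.span ℂ ({z | ∃ x ∈ nPlus n, z = mono n x 0} ∪
    {z | ∃ (x : G n) (k : ℤ), 0 < k ∧ z = mono n x k})

/-- The Borel subalgebra `𝔟̃ = 𝔥̃ ⊕ 𝔫̃₊`. -/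
def borelAff (n : ℕ) : Submodule ℂ (GAff n) := cartanAff n ⊔ nPlusAff n

/-- The root space `𝔤̃_α = {x | [h, x] = α(h) x for all h ∈ 𝔥̃}` of `α ∈ 𝔥̃*`. -/
def rootSpace (n : ℕ) (α : Module.Dual ℂ (cartanAff n)) : Submodule ℂ (GAff n) where
  carrier := {x | ∀ h : cartanAff n, ⁅(h : GAff n), x⁆ = α h • x}
  add_mem' hx hy h := by rw [lie_add, hx h, hy h, smul_add]
  zero_mem' h := by rw [lie_zero, smul_zero]
  smul_mem' c x hx h := by rw [lie_smul, hx h, smul_comm]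

/-- The positive roots: the nonzero `α ∈ 𝔥̃*` with a nonzero root space, contained in `𝔫̃₊`. -/
def IsPositiveRoot (n : ℕ) (α : Module.Dual ℂ (cartanAff n)) : Prop :=
  α ≠ 0 ∧ rootSpace n α ≠ ⊥ ∧ rootSpace n α ≤ nPlusAff n

/-! ### The set `D` of positive roots -/

/-- The linear map taking an element of `𝔤̃` to its coefficient at `t^0`, which lies in `𝔤`. -/
def zeroMode (n : ℕ) : GAff n →ₗ[ℂ] G n where
  toFun z := LieAlgebra.LoopAlgebra.toFinsupp ℂ ℤ (G n)
    ((LieAlgebra.ofProd (cocycle n)).symm z.left).1 0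
  map_add' x y := by simp
  map_smul' a x := by simp

/-- The root `(r, s)` of `B_n` as a functional on `𝔥̃`, zero on `c` and `d`: an element of `D₂`. -/
def rootD2 (n r s : ℕ) : Module.Dual ℂ (cartanAff n) :=
  ((posRoot n r s).comp (zeroMode n)).domRestrict (cartanAff n)

/-- The indivisible positive imaginary root `δ`: it is `1` on `d` and zero on `c` and on `𝔥`. -/
def delta (n : ℕ) : Module.Dual ℂ (cartanAff n) :=
  ({ toFun := fun z => z.right
     map_add' := fun _ _ => rfl
     map_smul' := fun _ _ => rfl } : GAff n →ₗ[ℂ] ℂ).domRestrict (cartanAff n)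

/-- The root `δ - (r, s)`: an element of `D₃`. -/
def rootD3 (n r s : ℕ) : Module.Dual ℂ (cartanAff n) := delta n - rootD2 n r s

/-- `D = D₁ ∪ D₂ ∪ D₃`, where `D₁ = {δ}`. -/
def D (n : ℕ) : Set (Module.Dual ℂ (cartanAff n)) :=
  {delta n} ∪ {α | ∃ r s, IsRootIndex n r s ∧ α = rootD2 n r s} ∪
    {α | ∃ r s, IsRootIndex n r s ∧ α = rootD3 n r s}

/-! ### Basic ideals -/

/-- `I` is a combinatorial ideal: an ideal of `𝔟̃` contained in `𝔫̃₊`, of finite codimension,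
which contains or meets trivially each root space of a positive root. -/
structure IsCombinatorialIdeal (n : ℕ) (I : Submodule ℂ (GAff n)) : Prop where
  le_nPlus : I ≤ nPlusAff n
  lie_mem : ∀ x ∈ borelAff n, ∀ y ∈ I, ⁅x, y⁆ ∈ I
  finite_codim : FiniteDimensional ℂ (↥(borelAff n) ⧸ I.submoduleOf (borelAff n))
  rootSpaces : ∀ α, IsPositiveRoot n α → I ⊓ rootSpace n α = ⊥ ∨ rootSpace n α ≤ I

/-- The support of `I`: the positive roots whose root spaces are contained in `I`. -/
def supp (n : ℕ) (I : Submodule ℂ (GAff n)) : Set (Module.Dual ℂ (cartanAff n)) :=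
  {α | IsPositiveRoot n α ∧ rootSpace n α ≤ I}

/-- A basic ideal: a combinatorial ideal whose support meets `D`. -/
def IsBasicIdeal (n : ℕ) (I : Submodule ℂ (GAff n)) : Prop :=
  IsCombinatorialIdeal n I ∧ (supp n I ∩ D n).Nonempty

/-! ### `B_n`-paths -/

/-- The alphabet `{r, f}`. -/
inductive Letter where
  | r
  | f
  deriving DecidableEq

/-- A `B_n`-path: a word of length `2 n` in `r` and `f`, each prefix of which contains at least
as many `r`'s as `f`'s. -/
def IsBPath (n : ℕ) (w : List Letter) : Prop :=
  w.length = 2 * n ∧ ∀ u, u <+: w → u.count Letter.f ≤ u.count Letter.r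

/-- `𝔅_n(i, j)`: the `B_n`-paths whose first and second `f` are at the positions `i < j` (counted
from `1`). Missing `f`'s are thought of as following the word immediately: a word with a single
`f`, at position `k`, belongs to `𝔅_n(k, 2n+1)`, and `r ⋯ r` belongs to `𝔅_n(2n+1, 2n+2)`. -/
def B (n i j : ℕ) : Set (List Letter) :=
  {w | IsBPath n w ∧ 1 ≤ i ∧ i < j ∧
    ∃ v, w ++ [Letter.f, Letter.f] =
      List.replicate (i - 1) Letter.r ++ Letter.f ::
        (List.replicate (j - i - 1) Letter.r ++ Letter.f :: v)}

/-! ### Admissible pairs -/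

/-- The lattice points on the path in the lower triangle given by `w`: it starts at `(-1, 0)`,
goes right by `(1, 0)` for each `r` and down by `(0, -1)` for each `f`. -/
def lowerPath (w : List Letter) : Set (ℤ × ℤ) :=
  {P | ∃ u, u <+: w ∧ P = (-1 + (u.count Letter.r : ℤ), -(u.count Letter.f : ℤ))}

/-- The lattice points on the path in the upper triangle given by `w`: it starts at `(2n, 1)`,
goes left by `(-1, 0)` for each `r` and up by `(0, 1)` for each `f`. -/
def upperPath (n : ℕ) (w : List Letter) : Set (ℤ × ℤ) :=
  {P | ∃ u, u <+: w ∧ P = (2 * (n : ℤ) - (u.count Letter.r : ℤ), 1 + (u.count Letter.f : ℤ))}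

/-- The unit box with northwest corner `(x, y)` lies to the northeast of the path `P`: some point
of the path is weakly southwest of the southwest corner `(x, y - 1)` of the box. -/
def IsNortheast (P : Set (ℤ × ℤ)) (x y : ℤ) : Prop :=
  ∃ v ∈ P, v.1 ≤ x ∧ v.2 ≤ y - 1

/-- `(p, q)` is the pair of `B_n`-paths of the ideal `I`: `p` separates the boxes of the roots of
`D₂` in the support of `I` (to its northeast) from the boxes of the other roots of `D₂`, and `q`
does the same for `D₃`. The box of `(r, s)` is the one in row `r` from the top and column `s` of
the lower triangle, with northwest corner `(s - 1, 1 - r)`; the box of `δ - (r, s)` is the one in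
row `r` from the bottom and column `2n - s` of the upper triangle, with northwest corner
`(2n - s - 1, r + 1)`. -/
structure IsPathPair (n : ℕ) (I : Submodule ℂ (GAff n)) (p q : List Letter) : Prop where
  left_isBPath : IsBPath n p
  right_isBPath : IsBPath n q
  left_separates : ∀ r s : ℕ, IsRootIndex n r s →
    (rootD2 n r s ∈ supp n I ↔ IsNortheast (lowerPath p) ((s : ℤ) - 1) (1 - (r : ℤ)))
  right_separates : ∀ r s : ℕ, IsRootIndex n r s →
    (rootD3 n r s ∈ supp n I ↔
      IsNortheast (upperPath n q) (2 * (n : ℤ) - (s : ℤ) - 1) ((r : ℤ) + 1))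

/-- `(p, q)` is admissible: it is the pair of `B_n`-paths of some basic ideal. -/
def IsAdmissible (n : ℕ) (p q : List Letter) : Prop :=
  ∃ I : Submodule ℂ (GAff n), IsBasicIdeal n I ∧ IsPathPair n I p q

end AffineB

end

/-! ### Combinatorics of `B_n`-paths: falls, boxes and counting. -/

namespace AffineB

open List

/-! ### First and second `f` of a path -/

/-! Write `𝔤` as matrices of size `2n + 1` that are skew, up to the scalars of the form, under
reflection in the antidiagonal. A root is then a pair of mirror positions: `(r, s)` sits in row `r`
and column `s + 1` at `t^0`, and `δ - (r, s)` at the transposed position at `t^1`. Adding roots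
composes positions, `(u, m)` and `(m, v)` giving `(u, v)`.

Stability under `𝔫₊` inside `D₂` and inside `D₃` is just the staircase shape of the two sets of
boxes (`Supported.add_upper`). The paths interact only through degree one, where the extreme case is
`δ - θ` with `θ = (1, 2n - 1) = e_1 + e_2`. The first boxes cut off by `p` in rows 1 and 2 are `(1,
a - 1)` and `(2, b - 2)`; adding `δ - θ` turns them into `δ - (2, 2n + 1 - a)` and `δ - (1, 2n + 2 -
b)`. That these two boxes lie northeast of `q` means exactly `j ≥ 2n + 4 - a` and `i ≥ 2n + 4 - b`.
This gives necessity (`IsPathPair.upperBox_one`, `IsPathPair.upperBox_two`).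

Conversely, once those two boxes lie northeast of `q`, the sum of any supported root of `D₂` and any
root of degree one is again supported (`RowBounds.supported_one`). So the boxes of `p` and `q`, with
the degree-one positions on or above the diagonal and everything of degree at least two, span a
basic ideal (`RowBounds.isCombinatorialIdeal`).

The count follows because each path lies in exactly one `B n i j`. -/

lemma exists_eq_replicate_append {l : List Letter} (h : Letter.f ∈ l) :
    ∃ k t, l = replicate k Letter.r ++ Letter.f :: t := by
  induction l with
  | nil => simp at h
  | cons x l ih =>
    cases x with
    | f => exact ⟨0, l, rfl⟩
    | r =>
      obtain ⟨k, t, rfl⟩ := ih (by simpa using h)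
      exact ⟨k + 1, t, rfl⟩

lemma replicate_append_inj {k k' : ℕ} {t t' : List Letter}
    (h : replicate k Letter.r ++ Letter.f :: t = replicate k' Letter.r ++ Letter.f :: t') :
    k = k' ∧ t = t' := by
  induction k generalizing k' with
  | zero =>
    cases k' with
    | zero => simpa using h
    | succ k' => simp [replicate_succ] at h
  | succ k ih =>
    cases k' with
    | zero => simp [replicate_succ] at h
    | succ k' =>
      simp only [replicate_succ, cons_append, cons.injEq, true_and] at h
      exact ⟨congrArg _ (ih h).1, (ih h).2⟩

lemma prefix_replicate_append {k : ℕ} {t u : List Letter}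
    (h : u <+: replicate k Letter.r ++ Letter.f :: t) :
    (∃ m ≤ k, u = replicate m Letter.r) ∨
      ∃ u', u' <+: t ∧ u = replicate k Letter.r ++ Letter.f :: u' := by
  induction k generalizing u with
  | zero =>
    cases u with
    | nil => exact Or.inl ⟨0, le_rfl, rfl⟩
    | cons x u =>
      simp only [replicate_zero, nil_append, cons_prefix_cons] at h
      exact Or.inr ⟨u, h.2, by simp [h.1]⟩
  | succ k ih =>
    cases u with
    | nil => exact Or.inl ⟨0, by simp, rfl⟩
    | cons x u =>
      simp only [replicate_succ, cons_append, cons_prefix_cons] at h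
      rcases ih h.2 with ⟨m, hm, rfl⟩ | ⟨u', hu', rfl⟩
      · exact Or.inl ⟨m + 1, by omega, by simp [h.1, replicate_succ]⟩
      · exact Or.inr ⟨u', hu', by simp [h.1, replicate_succ]⟩

variable {n i j : ℕ} {w : List Letter}

lemma exists_mem_B (hw : IsBPath n w) : ∃ i j, w ∈ B n i j := by
  obtain ⟨k, t, ht⟩ := exists_eq_replicate_append (l := w ++ [Letter.f, Letter.f]) (by simp)
  -- The two appended `f`'s make the total count at least two, and only one precedes `t`.
  have hf : Letter.f ∈ t := by
    have h := congrArg (count Letter.f) ht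
    simp only [count_append, count_replicate, count_cons, count_nil] at h
    simp at h
    exact count_pos_iff.1 (by omega)
  obtain ⟨m, v, rfl⟩ := exists_eq_replicate_append hf
  refine ⟨k + 1, k + m + 2, hw, by omega, by omega, v, ?_⟩
  rw [ht, show k + m + 2 - (k + 1) - 1 = m by omega, Nat.add_sub_cancel]

lemma eq_of_mem_B {i' j' : ℕ} (h : w ∈ B n i j) (h' : w ∈ B n i' j') : i = i' ∧ j = j' := by
  obtain ⟨-, hi, hij, v, hv⟩ := h
  obtain ⟨-, hi', hij', v', hv'⟩ := h'
  obtain ⟨h1, h2⟩ := replicate_append_inj (hv.symm.trans hv')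
  have h3 := (replicate_append_inj h2).1
  omega

lemma le_of_mem_B (h : w ∈ B n i j) : j ≤ 2 * n + 2 := by
  obtain ⟨hw, hi, hij, v, hv⟩ := h
  have := congrArg length hv
  simp [hw.1] at this
  omega

/-- The numbers of `r`'s and `f`'s in a prefix of a path with first and second `f` at `i`, `j`. -/
lemma prefix_counts (h : w ∈ B n i j) {u : List Letter} (hu : u <+: w) :
    (u.count Letter.f = 0 → u.count Letter.r + 1 ≤ i) ∧
    (1 ≤ u.count Letter.f → i ≤ u.count Letter.r + 1) ∧
    (u.count Letter.f ≤ 1 → u.count Letter.r + 2 ≤ j) ∧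
    (2 ≤ u.count Letter.f → j ≤ u.count Letter.r + 2) := by
  obtain ⟨-, hi, hij, v, hv⟩ := h
  have hu' := hu.trans (prefix_append w [Letter.f, Letter.f])
  rw [hv] at hu'
  rcases prefix_replicate_append hu' with ⟨m, hm, rfl⟩ | ⟨u', hu'', rfl⟩
  · simp [count_replicate]; omega
  · rcases prefix_replicate_append hu'' with ⟨m, hm, rfl⟩ | ⟨u', hu', rfl⟩
    · simp [count_replicate]; omega
    · simp [count_replicate]; omega

lemma exists_prefix_before_first (h : w ∈ B n i j) :
    ∃ u, u <+: w ∧ u.count Letter.f = 0 ∧ u.count Letter.r + 1 = i := by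
  have hj := le_of_mem_B h
  obtain ⟨hw, hi, hij, v, hv⟩ := h
  refine ⟨replicate (i - 1) Letter.r, ?_, by simp [count_replicate], by simp; omega⟩
  refine prefix_of_prefix_length_le (l₃ := w ++ [Letter.f, Letter.f]) (hv ▸ prefix_append _ _)
    (prefix_append _ _) ?_
  simp [hw.1]; omega

/-- For consecutive `f`'s the prefix before the first one already has `j - 2` letters `r`; otherwise
the word is cut just before the second `f`. -/
lemma exists_prefix_before_second (h : w ∈ B n i j) :
    ∃ u, u <+: w ∧ u.count Letter.f ≤ 1 ∧ u.count Letter.r + 2 = j := by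
  have hj := le_of_mem_B h
  obtain ⟨u, hu, hu0, hui⟩ := exists_prefix_before_first h
  obtain ⟨hw, hi, hij, v, hv⟩ := h
  by_cases hji : j = i + 1
  · exact ⟨u, hu, by omega, by omega⟩
  refine ⟨replicate (i - 1) Letter.r ++ Letter.f :: replicate (j - i - 1) Letter.r, ?_,
    by simp [count_replicate], by simp; omega⟩
  refine prefix_of_prefix_length_le (l₃ := w ++ [Letter.f, Letter.f])
    ⟨Letter.f :: v, by simp [hv]⟩ (prefix_append _ _) ?_
  have hlen := congrArg length hv
  simp only [length_append, hw.1, length_replicate, length_cons, length_nil] at hlen ⊢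
  -- If the cut fell outside `w`, the second `f` would be the last appended letter. The letter
  -- before it is then both an `r`, as `j > i + 1`, and the other appended `f`.
  by_contra hlt
  obtain rfl : v = [] := by rw [← length_eq_zero_iff]; omega
  have h1 : replicate (j - i - 1) Letter.r = replicate (j - i - 2) Letter.r ++ [Letter.r] := by
    rw [← replicate_succ']; congr 1; omega
  have h2 : (w ++ [Letter.f]) ++ [Letter.f] =
      ((replicate (i - 1) Letter.r ++ Letter.f :: replicate (j - i - 2) Letter.r) ++ [Letter.r])
        ++ [Letter.f] := by
    rw [append_assoc w]; simpa [h1] using hv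
  have h3 := (append_inj' (append_inj' h2 rfl).1 rfl).2
  simp at h3

lemma exists_prefix_after_first (h : w ∈ B n i j) (hi : i ≤ 2 * n) :
    ∃ u, u <+: w ∧ u.count Letter.f = 1 ∧ u.count Letter.r + 1 = i := by
  obtain ⟨hw, hi, hij, v, hv⟩ := h
  refine ⟨replicate (i - 1) Letter.r ++ [Letter.f], ?_, by simp [count_replicate],
    by simp; omega⟩
  refine prefix_of_prefix_length_le (l₃ := w ++ [Letter.f, Letter.f])
    ⟨_, by rw [hv, append_assoc]; rfl⟩ (prefix_append _ _) ?_
  simp [hw.1]; omega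

lemma exists_prefix_after_second (h : w ∈ B n i j) (hj : j ≤ 2 * n) :
    ∃ u, u <+: w ∧ u.count Letter.f = 2 ∧ u.count Letter.r + 2 = j := by
  obtain ⟨hw, hi, hij, v, hv⟩ := h
  refine ⟨replicate (i - 1) Letter.r ++ Letter.f ::
    (replicate (j - i - 1) Letter.r ++ [Letter.f]), ?_, by simp [count_replicate],
    by simp; omega⟩
  refine prefix_of_prefix_length_le (l₃ := w ++ [Letter.f, Letter.f])
    ⟨v, by simp [hv]⟩ (prefix_append _ _) ?_
  simp [hw.1]; omega

/-! ### The boxes northeast of a path -/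

/-- The box of the root `(r, s)` lies northeast of the path `p` in the lower triangle. -/
def LowerBox (p : List Letter) (r s : ℤ) : Prop := IsNortheast (lowerPath p) (s - 1) (1 - r)

/-- The box of the root `δ - (r, s)` lies northeast of the path `q` in the upper triangle. -/
def UpperBox (n : ℕ) (q : List Letter) (r s : ℤ) : Prop :=
  IsNortheast (upperPath n q) (2 * (n : ℤ) - s - 1) (r + 1)

lemma LowerBox.mono {p : List Letter} {r s r' s' : ℤ} (h : LowerBox p r s) (hr : r' ≤ r)
    (hs : s ≤ s') : LowerBox p r' s' := by
  obtain ⟨v, hv, h1, h2⟩ := h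
  exact ⟨v, hv, by omega, by omega⟩

/-- The inequalities are opposite to those of `LowerBox.mono`: in the upper triangle rows are
counted from the bottom and the column is `2n - s`. -/
lemma UpperBox.mono {q : List Letter} {r s r' s' : ℤ} (h : UpperBox n q r s) (hr : r ≤ r')
    (hs : s' ≤ s) : UpperBox n q r' s' := by
  obtain ⟨v, hv, h1, h2⟩ := h
  exact ⟨v, hv, by omega, by omega⟩

/-- A box in row 1 of the lower triangle needs a point reached after a fall, so the first `f` must
be a genuine letter. In the upper triangle the points before the fall decide, and no such bound is
needed. -/
lemma lowerBox_one_iff (h : w ∈ B n i j) (hi : i ≤ 2 * n) {s : ℤ} :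
    LowerBox w 1 s ↔ (i : ℤ) - 1 ≤ s := by
  constructor
  · rintro ⟨_, ⟨u, hu, rfl⟩, h1, h2⟩
    have := (prefix_counts h hu).2.1
    simp only at h1 h2
    omega
  · intro hs
    obtain ⟨u, hu, h1, h2⟩ := exists_prefix_after_first h hi
    exact ⟨_, ⟨u, hu, rfl⟩, by simp only; omega, by simp only; omega⟩

lemma lowerBox_two_iff (h : w ∈ B n i j) (hj : j ≤ 2 * n) {s : ℤ} :
    LowerBox w 2 s ↔ (j : ℤ) - 2 ≤ s := by
  constructor
  · rintro ⟨_, ⟨u, hu, rfl⟩, h1, h2⟩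
    have := (prefix_counts h hu).2.2.2
    simp only at h1 h2
    omega
  · intro hs
    obtain ⟨u, hu, h1, h2⟩ := exists_prefix_after_second h hj
    exact ⟨_, ⟨u, hu, rfl⟩, by simp only; omega, by simp only; omega⟩

lemma upperBox_one_iff (h : w ∈ B n i j) {s : ℤ} : UpperBox n w 1 s ↔ s ≤ (i : ℤ) - 2 := by
  constructor
  · rintro ⟨_, ⟨u, hu, rfl⟩, h1, h2⟩
    have := (prefix_counts h hu).1
    simp only at h1 h2
    omega
  · intro hs
    obtain ⟨u, hu, h1, h2⟩ := exists_prefix_before_first h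
    exact ⟨_, ⟨u, hu, rfl⟩, by simp only; omega, by simp only; omega⟩

lemma upperBox_two_iff (h : w ∈ B n i j) {s : ℤ} : UpperBox n w 2 s ↔ s ≤ (j : ℤ) - 3 := by
  constructor
  · rintro ⟨_, ⟨u, hu, rfl⟩, h1, h2⟩
    have := (prefix_counts h hu).2.2.1
    simp only at h1 h2
    omega
  · intro hs
    obtain ⟨u, hu, h1, h2⟩ := exists_prefix_before_second h
    exact ⟨_, ⟨u, hu, rfl⟩, by simp only; omega, by simp only; omega⟩

/-! ### Counting -/

instance : Fintype Letter := ⟨{Letter.r, Letter.f}, fun x => by cases x <;> simp⟩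

lemma finite_B (n i j : ℕ) : (B n i j).Finite :=
  (List.finite_length_eq Letter (2 * n)).subset fun _ hw => hw.1.1

/-- The finite sets `B n i j` are pairwise disjoint, and empty unless `i < j ≤ 2n + 2`. -/
lemma ncard_exists_mem_B (n k l : ℕ) :
    {q : List Letter | ∃ i j : ℕ, k ≤ i ∧ l ≤ j ∧ q ∈ B n i j}.ncard =
      ∑ i ∈ Finset.Icc k (2 * n + 2), ∑ j ∈ Finset.Icc l (2 * n + 2), (B n i j).ncard := by
  classical
  have hfin (x : ℕ × ℕ) : Set.Finite (B n x.1 x.2) := finite_B n x.1 x.2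
  have hset : {q : List Letter | ∃ i j : ℕ, k ≤ i ∧ l ≤ j ∧ q ∈ B n i j} =
      ((Finset.Icc k (2 * n + 2) ×ˢ Finset.Icc l (2 * n + 2)).biUnion
        fun x => (hfin x).toFinset : Finset (List Letter)) := by
    ext q
    simp only [Set.mem_ofPred_eq, Finset.coe_biUnion, Finset.mem_coe, Finset.mem_product,
      Finset.mem_Icc, Set.Finite.coe_toFinset, Set.mem_iUnion, exists_prop, Prod.exists]
    constructor
    · rintro ⟨i, j, hi, hj, hq⟩
      have h1 := le_of_mem_B hq
      have h2 := hq.2.2.1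
      exact ⟨i, j, by omega, hq⟩
    · rintro ⟨i, j, h, hq⟩
      exact ⟨i, j, h.1.1, h.2.1, hq⟩
  rw [hset, Set.ncard_coe_finset, Finset.card_biUnion, Finset.sum_product]
  · exact Finset.sum_congr rfl fun i _ => Finset.sum_congr rfl fun j _ =>
      (Set.ncard_eq_toFinset_card _ (hfin (i, j))).symm
  · intro x _ y _ hxy
    refine Finset.disjoint_left.2 fun q hx hy => ?_
    rw [Set.Finite.mem_toFinset] at hx hy
    obtain ⟨h1, h2⟩ := eq_of_mem_B hx hy
    exact hxy (Prod.ext h1 h2)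

end AffineB

/-! ### The matrix model of `𝔤` and its roots as matrix positions. -/

namespace AffineB

attribute [local instance 100] LieRing.ofAssociativeRing

/-! ### Matrix positions of `𝔤` -/

/-- The row and column indices of the matrices in `𝔤`. -/
abbrev Idx (n : ℕ) : Type := Unit ⊕ Fin n ⊕ Fin n

variable {n : ℕ}

/-- The index dual to `i` under the form which defines `𝔤`. -/
def Idx.dual : Idx n → Idx n
  | .inl u => .inl u
  | .inr (.inl l) => .inr (.inr l)
  | .inr (.inr l) => .inr (.inl l)

/-- The position of an index in the order in which `𝔫₊` is strictly upper triangular. -/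
def Idx.pos : Idx n → ℤ
  | .inl _ => n + 1
  | .inr (.inl l) => l + 1
  | .inr (.inr l) => 2 * n + 1 - l

/-- The nonzero entry in row `i` of the form which defines `𝔤`. -/
def Idx.form : Idx n → ℂ
  | .inl _ => 2
  | .inr _ => 1

/-- The diagonal entry with index `i` of `diag(0, c, -c)`. -/
def Idx.wt : Idx n → (Fin n → ℂ) → ℂ
  | .inl _, _ => 0
  | .inr (.inl l), c => c l
  | .inr (.inr l), c => -c l

@[simp] lemma dual_dual (i : Idx n) : i.dual.dual = i := by rcases i with _ | _ | _ <;> rfl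

lemma dual_injective : Function.Injective (Idx.dual (n := n)) :=
  Function.Involutive.injective dual_dual

@[simp] lemma pos_dual (i : Idx n) : i.dual.pos = 2 * n + 2 - i.pos := by
  rcases i with _ | _ | _ <;> simp [Idx.dual, Idx.pos] <;> ring

@[simp] lemma form_dual (i : Idx n) : i.dual.form = i.form := by
  rcases i with _ | _ | _ <;> rfl

lemma form_ne_zero (i : Idx n) : i.form ≠ 0 := by
  rcases i with _ | _ | _ <;> simp [Idx.form]

@[simp] lemma wt_dual (i : Idx n) (c : Fin n → ℂ) : i.dual.wt c = -i.wt c := by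
  rcases i with _ | _ | _ <;> simp [Idx.dual, Idx.wt]

lemma one_le_pos (i : Idx n) : 1 ≤ i.pos := by
  rcases i with _ | l | l <;> simp only [Idx.pos] <;> omega

lemma pos_le (i : Idx n) : i.pos ≤ 2 * n + 1 := by
  rcases i with _ | l | l <;> simp only [Idx.pos] <;> omega

lemma pos_injective : Function.Injective (Idx.pos (n := n)) := by
  intro i j h
  rcases i with _ | i | i <;> rcases j with _ | j | j <;> simp only [Idx.pos] at h
  · rfl
  · omega
  · omega
  · omega
  · rw [Fin.ext (a := i) (b := j) (by omega)]
  · omega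
  · omega
  · omega
  · rw [Fin.ext (a := i) (b := j) (by omega)]

lemma exists_pos_eq {u : ℤ} (h1 : 1 ≤ u) (h2 : u ≤ 2 * n + 1) : ∃ i : Idx n, i.pos = u := by
  rcases lt_trichotomy u (n + 1) with h | h | h
  · exact ⟨.inr (.inl ⟨(u - 1).toNat, by omega⟩), by simp only [Idx.pos]; omega⟩
  · exact ⟨.inl (), h.symm⟩
  · exact ⟨.inr (.inr ⟨(2 * n + 1 - u).toNat, by omega⟩), by simp only [Idx.pos]; omega⟩

lemma eq_dual_iff {i j : Idx n} : i = j.dual ↔ i.pos + j.pos = 2 * n + 2 := by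
  rw [← pos_injective.eq_iff, pos_dual]; omega

/-! ### Equality of weights -/

lemma eq_of_wt_eq {i j : Idx n} (h : ∀ c, i.wt c = j.wt c) : i = j := by
  have key (l l' : Fin n) (hc : ∀ c : Fin n → ℂ, c l = c l') : l = l' := by
    have := hc (Pi.single l 1)
    by_contra hl
    rw [Pi.single_eq_same, Pi.single_eq_of_ne (Ne.symm hl)] at this
    exact one_ne_zero this
  -- On the constant vector the three kinds of index have weights `0`, `1` and `-1`.
  have h1 := h fun _ => 1
  rcases i with _ | i | i <;> rcases j with _ | j | j <;>
    simp only [Idx.wt, neg_inj] at h h1 <;> first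
    | rfl
    | rw [key i j h]
    | (exfalso; norm_num at h1)

lemma exists_separating {i : Idx n} (hi : i ≠ i.dual) :
    ∃ c, i.wt c = 1 ∧ ∀ m, m ≠ i → m ≠ i.dual → m.wt c = 0 := by
  rcases i with _ | l | l
  · simp [Idx.dual] at hi
  · refine ⟨Pi.single l 1, by simp [Idx.wt], ?_⟩
    rintro (_ | m | m) h1 h2 <;> simp only [Idx.dual, ne_eq, Sum.inr.injEq, Sum.inl.injEq,
      reduceCtorEq, not_false_eq_true] at h1 h2 <;> simp [Idx.wt, *]
  · refine ⟨-Pi.single l 1, by simp [Idx.wt], ?_⟩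
    rintro (_ | m | m) h1 h2 <;> simp only [Idx.dual, ne_eq, Sum.inr.injEq, Sum.inl.injEq,
      reduceCtorEq, not_false_eq_true] at h1 h2 <;> simp [Idx.wt, *]

/-- On a vector separating `i` from all indices but its dual, the left side is `1`, while every
index other than `i` has weight `0` or `-1`. -/
lemma mem_pair_of_wt_add_eq {i k i' k' : Idx n} (hi : i ≠ i.dual) (hik : k ≠ i)
    (hik' : k ≠ i.dual) (h : ∀ c, i.wt c + k.wt c = i'.wt c + k'.wt c) : i = i' ∨ i = k' := by
  obtain ⟨c, h1, h2⟩ := exists_separating hi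
  have h3 := h c
  rw [h1, h2 k hik hik'] at h3
  by_contra! hcon
  have hval (m : Idx n) (hm : i ≠ m) : m.wt c = 0 ∨ m.wt c = -1 := by
    by_cases hm' : m = i.dual
    · right; rw [hm', wt_dual, h1]
    · left; exact h2 m hm.symm hm'
  rcases hval i' hcon.1 with h4 | h4 <;> rcases hval k' hcon.2 with h5 | h5 <;>
    rw [h4, h5] at h3 <;> norm_num at h3

/-- Two matrix positions off the antidiagonal have the same weight only if they are equal, dual
to each other, or both on the diagonal. -/
lemma eq_or_dual_of_wt_sub_eq {i j i' j' : Idx n} (hij : j ≠ i.dual)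
    (h : ∀ c, i.wt c - j.wt c = i'.wt c - j'.wt c) :
    (i' = i ∧ j' = j) ∨ (i' = j.dual ∧ j' = i.dual) ∨ (i = j ∧ i' = j') := by
  by_cases h1 : i = j
  · subst h1
    exact Or.inr (Or.inr ⟨rfl, eq_of_wt_eq fun c => by linear_combination -(h c)⟩)
  -- The equation is rewritten as an equality of sums with `j.dual` in place of `-j`. The separating
  -- argument needs an index of nonzero weight: `j.dual` if `i` is the central index, and `i`
  -- otherwise.
  by_cases h2 : i = i.dual
  · have hj : j.dual ≠ j.dual.dual := by
      intro hj
      have hi0 := eq_dual_iff.1 h2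
      have hj0 := eq_dual_iff.1 hj
      rw [pos_dual] at hj0
      exact h1 (pos_injective (by omega))
    have hsum (c) : j.dual.wt c + i.wt c = i'.wt c + j'.dual.wt c := by
      rw [wt_dual, wt_dual]; linear_combination h c
    rcases mem_pair_of_wt_add_eq hj (fun h => hij (by rw [h, dual_dual]))
      (by simpa using h1) hsum with h3 | h3
    · refine Or.inr (Or.inl ⟨h3.symm, ?_⟩)
      rw [← dual_dual j']
      congr 1
      refine eq_of_wt_eq fun c => ?_
      have := hsum c
      rw [h3] at this
      linear_combination -this
    · refine Or.inl ⟨eq_of_wt_eq fun c => ?_, (dual_injective h3).symm⟩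
      have := hsum c
      rw [h3] at this
      linear_combination -this
  · have hsum (c) : i.wt c + j.dual.wt c = i'.wt c + j'.dual.wt c := by
      rw [wt_dual, wt_dual]; linear_combination h c
    rcases mem_pair_of_wt_add_eq h2 (fun h => hij (by rw [← h, dual_dual]))
      (fun h => h1 (dual_injective h).symm) hsum with h3 | h3
    · refine Or.inl ⟨h3.symm, eq_of_wt_eq fun c => ?_⟩
      have := h c
      rw [← h3] at this
      linear_combination this
    · refine Or.inr (Or.inl ⟨eq_of_wt_eq fun c => ?_, by rw [h3, dual_dual]⟩)
      have := hsum c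
      rw [← h3] at this
      linear_combination -this

/-! ### The entries of the elements of `𝔤` -/

/-- The form has one nonzero entry in each row, at `(i, i.dual)`, so skew-adjointness relates each
entry to a single other one, its mirror image in the antidiagonal. -/
lemma mem_typeB_iff (x : Matrix (Idx n) (Idx n) ℂ) :
    x ∈ LieAlgebra.Orthogonal.typeB (Fin n) ℂ ↔
      ∀ i j : Idx n, i.form * x i j + j.form * x j.dual i.dual = 0 := by
  have hJ (i j : Idx n) : LieAlgebra.Orthogonal.JB (Fin n) ℂ i j =
      if j = i.dual then i.form else 0 := by
    rcases i with i | i | i <;> rcases j with j | j | j <;>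
      simp [LieAlgebra.Orthogonal.JB, LieAlgebra.Orthogonal.JD, Idx.dual, Idx.form,
        Matrix.one_apply, eq_comm]
  have h1 (i j : Idx n) : (x.transpose * LieAlgebra.Orthogonal.JB (Fin n) ℂ) i j =
      j.form * x j.dual i := by
    rw [Matrix.mul_apply, Finset.sum_eq_single j.dual]
    · simp [hJ, mul_comm]
    · intro k _ hk
      rw [hJ, if_neg (fun h => hk (by rw [h, dual_dual])), mul_zero]
    · simp
  have h2 (i j : Idx n) : (LieAlgebra.Orthogonal.JB (Fin n) ℂ * x) i j =
      i.form * x i.dual j := by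
    rw [Matrix.mul_apply, Finset.sum_eq_single i.dual]
    · simp [hJ]
    · intro k _ hk
      rw [hJ, if_neg hk, zero_mul]
    · simp
  rw [LieAlgebra.Orthogonal.typeB, mem_skewAdjointMatricesLieSubalgebra,
    mem_skewAdjointMatricesSubmodule, Matrix.IsSkewAdjoint, Matrix.IsAdjointPair, mul_neg]
  constructor
  · intro h i j
    have := congrFun (congrFun h i.dual) j
    rw [h1, Matrix.neg_apply, h2, dual_dual, form_dual] at this
    linear_combination this
  · intro h
    ext (i : Idx n) (j : Idx n)
    rw [h1, Matrix.neg_apply, h2]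
    have := h i.dual j
    rw [dual_dual, form_dual] at this
    linear_combination this

lemma form_mul_apply (x : G n) (i j : Idx n) :
    i.form * x.1 i j + j.form * x.1 j.dual i.dual = 0 :=
  (mem_typeB_iff x.1).1 x.2 i j

/-- Antidiagonal positions are their own mirror images. This is why no `2 e_i` is a root, and why
these positions are excluded throughout. -/
lemma apply_dual_eq_zero (x : G n) (i : Idx n) : x.1 i i.dual = 0 := by
  have h := form_mul_apply x i i.dual
  rw [dual_dual, form_dual] at h
  have h2 : (2 * i.form) * x.1 i i.dual = 0 := by linear_combination h
  exact (mul_eq_zero.1 h2).resolve_left (mul_ne_zero two_ne_zero (form_ne_zero i))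

lemma ne_dual_of_apply_ne_zero {x : G n} {i j : Idx n} (h : x.1 i j ≠ 0) : j ≠ i.dual := by
  rintro rfl
  exact h (apply_dual_eq_zero x i)

lemma apply_dual_ne_zero {x : G n} {i j : Idx n} (h : x.1 i j ≠ 0) : x.1 j.dual i.dual ≠ 0 := by
  intro h0
  have := form_mul_apply x i j
  rw [h0, mul_zero, add_zero] at this
  exact (mul_eq_zero.1 this).elim (form_ne_zero i) h

/-- The entries `x_1, …, x_n` of the diagonal `(0, x_1, …, x_n, -x_1, …, -x_n)`. -/
def diagVec (h : G n) : Fin n → ℂ := fun l => h.1 (.inr (.inl l)) (.inr (.inl l))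

lemma apply_self (h : G n) (i : Idx n) : h.1 i i = i.wt (diagVec h) := by
  rcases i with u | l | l
  · have := apply_dual_eq_zero h (.inl u)
    exact this
  · rfl
  · have := form_mul_apply h (.inr (.inl l)) (.inr (.inl l))
    simp only [Idx.form, Idx.dual, one_mul] at this
    simp only [Idx.wt, diagVec]
    linear_combination this

lemma lie_apply (x y : G n) (i j : Idx n) :
    (⁅x, y⁆ : G n).1 i j = ∑ m, (x.1 i m * y.1 m j - y.1 i m * x.1 m j) := by
  rw [Finset.sum_sub_distrib]
  rfl

lemma cartan_lie_apply {h : G n} (hh : h ∈ cartan n) (x : G n) (i j : Idx n) :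
    (⁅h, x⁆ : G n).1 i j = (i.wt (diagVec h) - j.wt (diagVec h)) * x.1 i j := by
  have hd : ∀ i j, i ≠ j → h.1 i j = 0 := fun i j hij => hh hij
  rw [lie_apply, Finset.sum_sub_distrib, Finset.sum_eq_single i, Finset.sum_eq_single j,
    apply_self, apply_self]
  · ring
  · intro m _ hm; rw [hd m j hm, mul_zero]
  · simp
  · intro m _ hm; rw [hd i m hm.symm, zero_mul]
  · simp

/-- The element `diag(0, c, -c)` of `𝔥`. -/
def cartanElt (c : Fin n → ℂ) : G n :=
  ⟨Matrix.diagonal fun i : Idx n => i.wt c, (mem_typeB_iff _).2 fun i j => by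
    by_cases h : i = j
    · subst h; simp
    · rw [Matrix.diagonal_apply_ne _ h,
        Matrix.diagonal_apply_ne _ fun h' => h (dual_injective h').symm]
      simp⟩

lemma cartanElt_mem (c : Fin n → ℂ) : cartanElt c ∈ cartan n := Matrix.isDiag_diagonal _

@[simp] lemma diagVec_cartanElt (c : Fin n → ℂ) : diagVec (cartanElt c) = c := by
  ext l
  simp [diagVec, cartanElt, Idx.wt]

/-- The standard root vector of `𝔤` with entries at the positions `(i, j)` and `(j*, i*)`. -/
def rootVec (i j : Idx n) : G n :=
  ⟨Matrix.single i j j.form - Matrix.single j.dual i.dual i.form, (mem_typeB_iff _).2 fun k l => by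
    have e1 : (j.dual = k ∧ i.dual = l) ↔ (i = l.dual ∧ j = k.dual) := by
      constructor <;> rintro ⟨h1, h2⟩
      · exact ⟨by rw [← h2, dual_dual], by rw [← h1, dual_dual]⟩
      · exact ⟨by rw [h2, dual_dual], by rw [h1, dual_dual]⟩
    have e2 : (j.dual = l.dual ∧ i.dual = k.dual) ↔ (i = k ∧ j = l) := by
      rw [dual_injective.eq_iff, dual_injective.eq_iff, and_comm]
    simp only [Matrix.sub_apply, Matrix.single_apply, e1, e2]
    split_ifs with h1 h2 h2
    · rw [h1.1, h1.2, ← form_dual l, ← h2.1, ← h1.1]; ring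
    · rw [h1.1, h1.2]; ring
    · rw [h2.1, h2.2, form_dual, form_dual]; ring
    · ring⟩

lemma rootVec_apply (i j k l : Idx n) : (rootVec i j).1 k l =
    (if i = k ∧ j = l then j.form else 0) - if j.dual = k ∧ i.dual = l then i.form else 0 := by
  simp [rootVec, Matrix.single_apply]

lemma rootVec_apply_ne_zero {i j : Idx n} (h : j ≠ i.dual) : (rootVec i j).1 i j ≠ 0 := by
  rw [rootVec_apply, if_pos ⟨rfl, rfl⟩, if_neg fun h' => h h'.2.symm, sub_zero]
  exact form_ne_zero j

lemma of_rootVec_apply_ne_zero {i j k l : Idx n} (h : (rootVec i j).1 k l ≠ 0) :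
    (k = i ∧ l = j) ∨ (k = j.dual ∧ l = i.dual) := by
  rw [rootVec_apply] at h
  by_contra! hcon
  rw [if_neg fun h' => hcon.1 h'.1.symm h'.2.symm, if_neg fun h' => hcon.2 h'.1.symm h'.2.symm,
    sub_zero] at h
  exact h rfl

/-- Each entry is produced twice, by `rootVec` at its position and at the mirror position, whence
the factor `1/2`. -/
lemma eq_sum_rootVec (x : G n) :
    x = ∑ i : Idx n, ∑ j : Idx n, ((2 : ℂ)⁻¹ * x.1 i j * j.form⁻¹) • rootVec i j := by
  apply Subtype.ext
  ext (k : Idx n) (l : Idx n)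
  have hcoe : (∑ i : Idx n, ∑ j : Idx n, ((2 : ℂ)⁻¹ * x.1 i j * j.form⁻¹) • rootVec i j : G n).1 k l =
      ∑ i : Idx n, ∑ j : Idx n, ((2 : ℂ)⁻¹ * x.1 i j * j.form⁻¹) * (rootVec i j).1 k l := by
    let φ : G n →ₗ[ℂ] ℂ :=
      { toFun := fun y => y.1 k l, map_add' := fun _ _ => rfl, map_smul' := fun _ _ => rfl }
    have hφ (y : G n) : y.1 k l = φ y := rfl
    rw [hφ, map_sum]
    refine Finset.sum_congr rfl fun i _ => ?_
    rw [map_sum]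
    exact Finset.sum_congr rfl fun j _ => map_smul φ _ _
  rw [hcoe]
  simp only [rootVec_apply, mul_sub, Finset.sum_sub_distrib]
  have h1 : ∑ i : Idx n, ∑ j : Idx n, (2 : ℂ)⁻¹ * x.1 i j * j.form⁻¹ * (if i = k ∧ j = l then j.form else 0) =
      2⁻¹ * x.1 k l := by
    rw [Finset.sum_eq_single k, Finset.sum_eq_single l]
    · rw [if_pos ⟨rfl, rfl⟩]; field_simp [form_ne_zero l]
    · intro j _ hj; rw [if_neg fun h => hj h.2, mul_zero]
    · simp
    · intro i _ hi
      exact Finset.sum_eq_zero fun j _ => by rw [if_neg fun h => hi h.1, mul_zero]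
    · simp
  have h2 : ∑ i : Idx n, ∑ j : Idx n, (2 : ℂ)⁻¹ * x.1 i j * j.form⁻¹ *
      (if j.dual = k ∧ i.dual = l then i.form else 0) = -(2⁻¹ * x.1 k l) := by
    rw [Finset.sum_eq_single l.dual, Finset.sum_eq_single k.dual]
    · rw [if_pos ⟨dual_dual _, dual_dual _⟩, form_dual, form_dual]
      have := form_mul_apply x k l
      have hk := form_ne_zero k
      field_simp
      linear_combination this
    · intro j _ hj; rw [if_neg fun h => hj (by rw [← h.1, dual_dual]), mul_zero]
    · simp
    · intro i _ hi
      exact Finset.sum_eq_zero fun j _ => by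
        rw [if_neg fun h => hi (by rw [← h.2, dual_dual]), mul_zero]
    · simp
  rw [h1, h2]
  ring

/-! ### Positive roots as weights of matrix positions -/

lemma eps_apply {r : ℕ} {i : Idx n} (hi : i.pos = r) (hr : r ≤ n + 1) (h : G n) :
    eps n r h = i.wt (diagVec h) := by
  have h1 := one_le_pos i
  rcases i with u | l | l <;> simp only [Idx.pos] at hi h1
  -- The central index has position `n + 1`, where `eps` takes its default value `0`.
  · rw [eps, dif_neg (by omega)]; rfl
  · obtain rfl : r = l + 1 := by omega
    rw [eps, dif_pos (by omega)]; rfl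
  · omega

lemma sum_simpleRoot {r s : ℕ} (h : r ≤ s + 1) :
    ∑ i ∈ Finset.Icc r s, simpleRoot n i = eps n r - eps n (s + 1) := by
  induction s with
  | zero =>
    rcases Nat.le_one_iff_eq_zero_or_eq_one.1 h with rfl | rfl <;> simp [simpleRoot]
  | succ s ih =>
    rcases Nat.lt_or_ge (s + 1) r with h' | h'
    · obtain rfl : r = s + 1 + 1 := by omega
      simp
    · rw [Finset.sum_Icc_succ_top h', ih h', simpleRoot]; abel

lemma posRoot_apply {r s : ℕ} (hrs : IsRootIndex n r s) {i j : Idx n} (hi : i.pos = r)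
    (hj : j.pos = s + 1) (h : G n) :
    posRoot n r s h = i.wt (diagVec h) - j.wt (diagVec h) := by
  obtain ⟨h1, h2, h3⟩ := hrs
  rw [posRoot]
  rcases Nat.lt_or_ge n s with hs | hs
  -- Both sums telescope, to `e_r` and `e_{2n+1-s}`; column `s + 1` is dual to position `2n + 1 -
  -- s`, hence has weight `-e_{2n+1-s}`.
  · rw [min_eq_right hs.le, sum_simpleRoot (by omega), sum_simpleRoot (by omega)]
    have e1 := eps_apply hi (by omega) h
    have e2 := eps_apply (r := 2 * n + 1 - s) (i := j.dual) (by rw [pos_dual]; omega) (by omega) h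
    have e3 := eps_apply (r := n + 1) (i := .inl ()) (by simp [Idx.pos]) (by omega) h
    simp only [LinearMap.add_apply, LinearMap.sub_apply, e1, e2, e3, wt_dual]
    simp only [Idx.wt]; ring
  · rw [min_eq_left hs, sum_simpleRoot (by omega),
      Finset.Icc_eq_empty (by omega), Finset.sum_empty, add_zero]
    have e1 := eps_apply hi (by omega) h
    have e2 := eps_apply (r := s + 1) (i := j) (by rw [hj]; push_cast; rfl) (by omega) h
    rw [LinearMap.sub_apply, e1, e2]

lemma IsRootIndex.exists_idx {r s : ℕ} (hrs : IsRootIndex n r s) :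
    ∃ i j : Idx n, i.pos = r ∧ j.pos = s + 1 := by
  obtain ⟨h1, h2, h3⟩ := hrs
  obtain ⟨i, hi⟩ := exists_pos_eq (n := n) (u := r) (by omega) (by omega)
  obtain ⟨j, hj⟩ := exists_pos_eq (n := n) (u := s + 1) (by omega) (by omega)
  exact ⟨i, j, hi, hj⟩

/-- A position beyond the antidiagonal is first reflected, which keeps the weight and brings it to
the form `(r, s + 1)` with `r + s ≤ 2n`. -/
lemma exists_posRoot_eq {i j : Idx n} (hij : i.pos < j.pos) (hd : j ≠ i.dual) :
    ∃ r s, IsRootIndex n r s ∧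
      ∀ h : G n, posRoot n r s h = i.wt (diagVec h) - j.wt (diagVec h) := by
  have hi := one_le_pos i
  have hj := pos_le j
  rw [Ne, eq_dual_iff] at hd
  rcases lt_or_gt_of_ne hd with h | h
  · have hrs : IsRootIndex n i.pos.toNat (j.pos - 1).toNat := ⟨by omega, by omega, by omega⟩
    exact ⟨_, _, hrs, fun h => posRoot_apply hrs (by omega) (by omega) h⟩
  · have hrs : IsRootIndex n j.dual.pos.toNat (i.dual.pos - 1).toNat := by
      rw [pos_dual, pos_dual]; exact ⟨by omega, by omega, by omega⟩
    refine ⟨_, _, hrs, fun h => ?_⟩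
    rw [posRoot_apply hrs (i := j.dual) (j := i.dual) (by rw [pos_dual]; omega)
      (by rw [pos_dual]; omega) h, wt_dual, wt_dual]
    ring

lemma mem_finRootSpace {γ : G n →ₗ[ℂ] ℂ} {x : G n}
    (hx : ∀ i j : Idx n, x.1 i j ≠ 0 → ∀ h : G n, γ h = i.wt (diagVec h) - j.wt (diagVec h)) :
    x ∈ finRootSpace n γ := by
  intro h hh
  apply Subtype.ext
  ext (i : Idx n) (j : Idx n)
  rw [cartan_lie_apply hh]
  change _ = γ h * x.1 i j
  by_cases h0 : x.1 i j = 0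
  · rw [h0, mul_zero, mul_zero]
  · rw [hx i j h0 h]

lemma rootVec_mem_nPlus {i j : Idx n} (hij : i.pos < j.pos) : rootVec i j ∈ nPlus n := by
  by_cases hd : j = i.dual
  · have : rootVec i j = 0 := by
      apply Subtype.ext
      ext (k : Idx n) (l : Idx n)
      by_contra h0
      have h1 := of_rootVec_apply_ne_zero h0
      have h2 := ne_dual_of_apply_ne_zero h0
      rw [hd, dual_dual, or_self] at h1
      exact h2 (by rw [h1.1, h1.2])
    rw [this]
    exact zero_mem _
  · obtain ⟨r, s, hrs, h⟩ := exists_posRoot_eq hij hd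
    refine Submodule.mem_iSup_of_mem r (Submodule.mem_iSup_of_mem s
      (Submodule.mem_iSup_of_mem hrs (mem_finRootSpace fun k l hkl y => ?_)))
    rcases of_rootVec_apply_ne_zero hkl with ⟨rfl, rfl⟩ | ⟨rfl, rfl⟩
    · exact h y
    · rw [h y, wt_dual, wt_dual]; ring

lemma mem_nPlus_of_upper {x : G n} (hx : ∀ i j : Idx n, x.1 i j ≠ 0 → i.pos < j.pos) : x ∈ nPlus n := by
  rw [eq_sum_rootVec x]
  refine sum_mem fun i _ => sum_mem fun j _ => ?_
  by_cases h : x.1 i j = 0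
  · rw [h]; simp
  · exact Submodule.smul_mem _ _ (rootVec_mem_nPlus (hx i j h))

/-- The functional on which the weight of an index is `n + 1` minus its position. -/
lemma exists_wt_eq_pos (n : ℕ) : ∃ c : Fin n → ℂ, ∀ i : Idx n, i.wt c = ((n + 1 - i.pos : ℤ) : ℂ) := by
  refine ⟨fun l => ((n - l : ℤ) : ℂ), ?_⟩
  rintro (u | l | l) <;> simp only [Idx.wt, Idx.pos] <;> push_cast <;> ring

/-- The functional of `exists_wt_eq_pos` measures heights: at `(i, j)` it takes the value `j.pos -
i.pos`, which is `s + 1 - r > 0` on the root `(r, s)`. -/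
lemma upper_of_mem_nPlus {x : G n} (hx : x ∈ nPlus n) :
    ∀ i j : Idx n, x.1 i j ≠ 0 → i.pos < j.pos := by
  let U : Submodule ℂ (G n) :=
    { carrier := {x | ∀ i j : Idx n, ¬ i.pos < j.pos → x.1 i j = 0}
      add_mem' := fun {x y} hx hy i j h => by
        change x.1 i j + y.1 i j = 0
        rw [hx i j h, hy i j h, add_zero]
      zero_mem' := fun i j _ => rfl
      smul_mem' := fun c x hx i j h => by
        change c * x.1 i j = 0
        rw [hx i j h, mul_zero] }
  have hle : nPlus n ≤ U := by
    refine iSup_le fun r => iSup_le fun s => iSup_le fun hrs => ?_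
    intro x hx i j hij
    by_contra h0
    obtain ⟨k, l, hk, hl⟩ := hrs.exists_idx
    obtain ⟨c, hc⟩ := exists_wt_eq_pos n
    have h1 := congrFun (congrFun (congrArg Subtype.val (hx _ (cartanElt_mem c))) i) j
    rw [cartan_lie_apply (cartanElt_mem c)] at h1
    have h2 := mul_right_cancel₀ h0
      (h1.trans (show _ = posRoot n r s (cartanElt c) * x.1 i j from rfl))
    rw [posRoot_apply hrs hk hl, diagVec_cartanElt, hc, hc, hc, hc] at h2
    norm_cast at h2
    have := hrs.2.1
    omega
  intro i j h
  by_contra hij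
  exact h (hle hx i j hij)

end AffineB

/-! ### Coordinates, weights and root spaces of the affine algebra. -/

noncomputable section

namespace AffineB

attribute [local instance 100] LieRing.ofAssociativeRing

variable {n : ℕ}

/-! ### Coordinates of the affine algebra -/

/-- The coefficient at `t^k` of an element of `𝔤̃`. -/
def coef (n : ℕ) (k : ℤ) : GAff n →ₗ[ℂ] G n where
  toFun z := LieAlgebra.LoopAlgebra.toFinsupp ℂ ℤ (G n)
    ((LieAlgebra.ofProd (cocycle n)).symm z.left).1 k
  map_add' x y := by simp
  map_smul' a x := by simp

/-- The coefficient of `c`. -/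
def centCoef (n : ℕ) : GAff n →ₗ[ℂ] ℂ where
  toFun z := TrivialLieModule.equiv ℂ (Loop n) ℂ ((LieAlgebra.ofProd (cocycle n)).symm z.left).2
  map_add' x y := by simp
  map_smul' a x := by simp

/-- The coefficient of `d`. -/
def degCoef (n : ℕ) : GAff n →ₗ[ℂ] ℂ where
  toFun z := z.right
  map_add' _ _ := rfl
  map_smul' _ _ := rfl

lemma GAff_ext {z w : GAff n} (h : ∀ k, coef n k z = coef n k w)
    (hc : centCoef n z = centCoef n w) (hd : degCoef n z = degCoef n w) : z = w := by
  obtain ⟨zl, zr⟩ := z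
  obtain ⟨wl, wr⟩ := w
  have h1 : zl = wl := by
    apply (LieAlgebra.ofProd (cocycle n)).symm.injective
    refine Prod.ext ?_ ?_
    · exact (LieAlgebra.LoopAlgebra.toFinsupp ℂ ℤ (G n)).injective (Finsupp.ext h)
    · exact (TrivialLieModule.equiv ℂ (Loop n) ℂ).injective hc
  have h2 : zr = wr := hd
  rw [h1, h2]

lemma coef_mono (x : G n) (k l : ℤ) : coef n l (mono n x k) = if l = k then x else 0 := by
  change LieAlgebra.LoopAlgebra.toFinsupp ℂ ℤ (G n) _ l = _
  simp only [mono, Equiv.symm_apply_apply, LieAlgebra.LoopAlgebra.toFinsupp_single_tmul]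
  rw [Finsupp.single_apply]
  simp [eq_comm]

lemma centCoef_mono (x : G n) (k : ℤ) : centCoef n (mono n x k) = 0 := rfl

lemma degCoef_mono (x : G n) (k : ℤ) : degCoef n (mono n x k) = 0 := rfl

lemma coef_cElt (k : ℤ) : coef n k (cElt n) = 0 := by
  change LieAlgebra.LoopAlgebra.toFinsupp ℂ ℤ (G n) 0 k = _
  simp

lemma coef_dElt (k : ℤ) : coef n k (dElt n) = 0 := by
  change LieAlgebra.LoopAlgebra.toFinsupp ℂ ℤ (G n) 0 k = _
  simp

lemma degCoef_cElt : degCoef n (cElt n) = 0 := rfl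

lemma degCoef_dElt : degCoef n (dElt n) = 1 := rfl

lemma finite_coef_support (z : GAff n) : ∃ s : Finset ℤ, ∀ k ∉ s, coef n k z = 0 :=
  ⟨(LieAlgebra.LoopAlgebra.toFinsupp ℂ ℤ (G n)
    ((LieAlgebra.ofProd (cocycle n)).symm z.left).1).support,
    fun _ hk => Finsupp.notMem_support_iff.1 hk⟩

lemma exists_eq_sum_mono {z : GAff n} (hc : centCoef n z = 0) (hd : degCoef n z = 0) :
    ∃ s : Finset ℤ, z = ∑ k ∈ s, mono n (coef n k z) k := by
  obtain ⟨s, hs⟩ := finite_coef_support z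
  refine ⟨s, GAff_ext (fun l => ?_) ?_ ?_⟩
  · simp only [map_sum, coef_mono]
    rw [Finset.sum_ite_eq]
    split_ifs with h
    · rfl
    · exact hs l h
  · simp only [map_sum, centCoef_mono, Finset.sum_const_zero, hc]
  · simp only [map_sum, degCoef_mono, Finset.sum_const_zero, hd]

lemma toFinsupp_lie (x : G n) (k l : ℤ) (y : Loop n) :
    LieAlgebra.LoopAlgebra.toFinsupp ℂ ℤ (G n)
      ⁅((AddMonoidAlgebra.single k 1 : AddMonoidAlgebra ℂ ℤ) ⊗ₜ[ℂ] x : Loop n), y⁆ l =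
      ⁅x, LieAlgebra.LoopAlgebra.toFinsupp ℂ ℤ (G n) y (l - k)⁆ := by
  induction y using loop_induction with
  | add y y' hy hy' =>
    have h1 (z : Loop n) : ⁅z, y + y'⁆ = ⁅z, y⁆ + ⁅z, y'⁆ := lie_add z y y'
    rw [h1, map_add, map_add, Finsupp.add_apply, Finsupp.add_apply, lie_add, hy, hy']
  | tmul m y =>
    rw [LieAlgebra.ExtendScalars.bracket_tmul, AddMonoidAlgebra.single_mul_single, mul_one,
      LieAlgebra.LoopAlgebra.toFinsupp_single_tmul, LieAlgebra.LoopAlgebra.toFinsupp_single_tmul,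
      Finsupp.single_apply, Finsupp.single_apply]
    by_cases h : k + m = l
    · rw [if_pos h, if_pos (by omega)]
    · rw [if_neg h, if_neg (by omega), lie_zero]

lemma toFinsupp_loopDegree (y : Loop n) (l : ℤ) :
    LieAlgebra.LoopAlgebra.toFinsupp ℂ ℤ (G n) (loopDegree n y) l =
      (l : ℂ) • LieAlgebra.LoopAlgebra.toFinsupp ℂ ℤ (G n) y l := by
  induction y using loop_induction with
  | add y y' hy hy' => simp only [map_add, Finsupp.add_apply, hy, hy', smul_add]
  | tmul m y =>
    rw [loopDegree_tmul, map_smul, Finsupp.smul_apply,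
      LieAlgebra.LoopAlgebra.toFinsupp_single_tmul, Finsupp.single_apply]
    split_ifs with h
    · rw [h]
    · simp

lemma cocycle_single (x : G n) (k : ℤ) (y : Loop n) :
    TrivialLieModule.equiv ℂ (Loop n) ℂ
      ((cocycle n).1 ((AddMonoidAlgebra.single k 1 : AddMonoidAlgebra ℂ ℤ) ⊗ₜ[ℂ] x) y) =
      k * killingForm ℂ (G n) x (LieAlgebra.LoopAlgebra.toFinsupp ℂ ℤ (G n) y (-k)) := by
  induction y using loop_induction with
  | add y y' hy hy' => simp only [map_add, Finsupp.add_apply, hy, hy', mul_add]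
  | tmul m y =>
    rw [cocycle_tmul, LieAlgebra.LoopAlgebra.toFinsupp_single_tmul, Finsupp.single_apply,
      LinearEquiv.apply_symm_apply]
    by_cases h : k + m = 0
    · rw [if_pos h, if_pos (by omega)]
    · rw [if_neg h, if_neg (by omega), map_zero, mul_zero]

/-- The component of an element of `𝔤̃` in the loop algebra. -/
def loopPart (z : GAff n) : Loop n := ((LieAlgebra.ofProd (cocycle n)).symm z.left).1

lemma coef_apply (z : GAff n) (k : ℤ) :
    coef n k z = LieAlgebra.LoopAlgebra.toFinsupp ℂ ℤ (G n) (loopPart z) k := rfl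

lemma loopPart_mono (x : G n) (k : ℤ) :
    loopPart (mono n x k) = (AddMonoidAlgebra.single k 1 : AddMonoidAlgebra ℂ ℤ) ⊗ₜ[ℂ] x := rfl

lemma loopPart_lie (z w : GAff n) :
    loopPart ⁅z, w⁆ = ⁅loopPart z, loopPart w⁆ + degCoef n z • loopDegree n (loopPart w) -
      degCoef n w • loopDegree n (loopPart z) := rfl

lemma centCoef_lie (z w : GAff n) :
    centCoef n ⁅z, w⁆ =
      TrivialLieModule.equiv ℂ (Loop n) ℂ ((cocycle n).1 (loopPart z) (loopPart w)) := by
  have h : centCoef n ⁅z, w⁆ = TrivialLieModule.equiv ℂ (Loop n) ℂ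
      ((cocycle n).1 (loopPart z) (loopPart w) +
        ⁅loopPart z, ((LieAlgebra.ofProd (cocycle n)).symm w.left).2⁆ -
        ⁅loopPart w, ((LieAlgebra.ofProd (cocycle n)).symm z.left).2⁆ +
        degCoef n z • 0 - degCoef n w • 0) := rfl
  rw [h, LieModule.IsTrivial.trivial, LieModule.IsTrivial.trivial]
  simp

lemma coef_mono_lie (x : G n) (k l : ℤ) (z : GAff n) :
    coef n l ⁅mono n x k, z⁆ =
      ⁅x, coef n (l - k) z⁆ - (degCoef n z * l) • coef n l (mono n x k) := by
  rw [coef_apply, loopPart_lie, degCoef_mono, zero_smul, add_zero, map_sub, Finsupp.sub_apply,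
    map_smul, Finsupp.smul_apply, toFinsupp_loopDegree, loopPart_mono, toFinsupp_lie, mul_smul]
  rfl

lemma centCoef_mono_lie (x : G n) (k : ℤ) (z : GAff n) :
    centCoef n ⁅mono n x k, z⁆ = k * killingForm ℂ (G n) x (coef n (-k) z) := by
  rw [centCoef_lie, loopPart_mono, cocycle_single]
  rfl

lemma degCoef_lie (z w : GAff n) : degCoef n ⁅z, w⁆ = 0 := by
  change ⁅z.right, w.right⁆ = 0
  rw [LieRing.of_associative_ring_bracket, mul_comm, sub_self]

lemma loopPart_dElt : loopPart (dElt n) = 0 := rfl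

lemma loopPart_cElt : loopPart (cElt n) = 0 := rfl

lemma coef_dElt_lie (l : ℤ) (z : GAff n) : coef n l ⁅dElt n, z⁆ = (l : ℂ) • coef n l z := by
  have h : ⁅(0 : Loop n), loopPart z⁆ = 0 := zero_lie (loopPart z)
  rw [coef_apply, loopPart_lie, loopPart_dElt, degCoef_dElt, map_zero, smul_zero, sub_zero,
    one_smul, h, zero_add, toFinsupp_loopDegree]
  rfl

lemma centCoef_dElt_lie (z : GAff n) : centCoef n ⁅dElt n, z⁆ = 0 := by
  rw [centCoef_lie, loopPart_dElt, map_zero, LinearMap.zero_apply, map_zero]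

lemma cElt_lie (z : GAff n) : ⁅cElt n, z⁆ = 0 := by
  have h : ⁅(0 : Loop n), loopPart z⁆ = 0 := zero_lie (loopPart z)
  refine GAff_ext (fun l => ?_) ?_ ?_
  · rw [coef_apply, loopPart_lie, loopPart_cElt, degCoef_cElt, map_zero, smul_zero, sub_zero,
      zero_smul, h, zero_add, map_zero, map_zero]
    rfl
  · rw [centCoef_lie, loopPart_cElt, map_zero, LinearMap.zero_apply, map_zero, map_zero]
  · rw [degCoef_lie, map_zero]

/-! ### The Cartan subalgebra and the root spaces -/

lemma dElt_mem : dElt n ∈ cartanAff n := Submodule.subset_span (by simp)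

lemma mono_mem_cartanAff {h : G n} (hh : h ∈ cartan n) : mono n h 0 ∈ cartanAff n :=
  Submodule.subset_span (Or.inr ⟨h, hh, rfl⟩)

/-- The bracket with an element of `𝔥̃`, in coordinates. -/
lemma cartanAff_lie {h : GAff n} (hh : h ∈ cartanAff n) (z : GAff n) :
    coef n 0 h ∈ cartan n ∧ centCoef n ⁅h, z⁆ = 0 ∧
      ∀ k, coef n k ⁅h, z⁆ = ⁅coef n 0 h, coef n k z⁆ + (degCoef n h * k) • coef n k z := by
  induction hh using Submodule.span_induction with
  | mem h hh =>
    rcases hh with (rfl | rfl) | ⟨x, hx, rfl⟩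
    · refine ⟨by rw [coef_cElt]; exact zero_mem _, by rw [cElt_lie, map_zero], fun k => ?_⟩
      rw [cElt_lie, map_zero, coef_cElt, zero_lie, degCoef_cElt, zero_mul, zero_smul, add_zero]
    · refine ⟨by rw [coef_dElt]; exact zero_mem _, centCoef_dElt_lie z, fun k => ?_⟩
      rw [coef_dElt_lie, coef_dElt, zero_lie, degCoef_dElt, one_mul, zero_add]
    · refine ⟨by rw [coef_mono, if_pos rfl]; exact hx, ?_, fun k => ?_⟩
      · rw [centCoef_mono_lie, Int.cast_zero, zero_mul]
      · rw [coef_mono_lie, coef_mono, coef_mono, if_pos rfl, degCoef_mono, zero_mul, zero_smul,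
          add_zero, sub_zero]
        split_ifs with hk
        · rw [hk, Int.cast_zero, mul_zero, zero_smul, sub_zero]
        · rw [smul_zero, sub_zero]
  | zero =>
    simp only [zero_lie, map_zero, zero_mul, zero_smul, add_zero, implies_true, and_true]
    exact zero_mem _
  | add x y _ _ hx hy =>
    refine ⟨by rw [map_add]; exact add_mem hx.1 hy.1,
      by rw [add_lie, map_add, hx.2.1, hy.2.1, add_zero], fun k => ?_⟩
    rw [add_lie, map_add, hx.2.2, hy.2.2, map_add, map_add, add_lie, add_mul, add_smul]
    abel
  | smul a x _ hx =>
    refine ⟨by rw [map_smul]; exact Submodule.smul_mem _ a hx.1,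
      by rw [smul_lie, map_smul, hx.2.1, smul_zero], fun k => ?_⟩
    rw [smul_lie, map_smul, hx.2.2, map_smul, map_smul, smul_lie, smul_add, smul_smul,
      smul_eq_mul, mul_assoc]

/-- `α` is the weight of the matrix position `(i, j)` of the coefficient at `t^k`. -/
def IsWeight (α : Module.Dual ℂ (cartanAff n)) (k : ℤ) (i j : Idx n) : Prop :=
  ∀ h : cartanAff n, α h = i.wt (diagVec (coef n 0 h.1)) - j.wt (diagVec (coef n 0 h.1)) +
    degCoef n h.1 * k

lemma mem_rootSpace {α : Module.Dual ℂ (cartanAff n)} {z : GAff n} (hc : centCoef n z = 0)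
    (hd : degCoef n z = 0)
    (h : ∀ k (i j : Idx n), (coef n k z).1 i j ≠ 0 → IsWeight α k i j) : z ∈ rootSpace n α := by
  intro y
  obtain ⟨h1, h2, h3⟩ := cartanAff_lie y.2 z
  refine GAff_ext (fun k => ?_) ?_ ?_
  · rw [h3, map_smul]
    apply Subtype.ext
    ext (i : Idx n) (j : Idx n)
    change (⁅coef n 0 y.1, coef n k z⁆ : G n).1 i j + (degCoef n y.1 * k) * (coef n k z).1 i j =
      α y * (coef n k z).1 i j
    rw [cartan_lie_apply h1]
    by_cases h0 : (coef n k z).1 i j = 0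
    · simp [h0]
    · rw [h k i j h0 y]; ring
  · rw [h2, map_smul, hc, smul_zero]
  · rw [degCoef_lie, map_smul, hd, smul_zero]

/-- Brackets with `𝔥̃` have no component along `c` or `d`, so a nonzero weight kills those
components; the remaining coordinates are eigenvectors separately. -/
lemma of_mem_rootSpace {α : Module.Dual ℂ (cartanAff n)} (hα : α ≠ 0) {z : GAff n}
    (hz : z ∈ rootSpace n α) : centCoef n z = 0 ∧ degCoef n z = 0 ∧
      ∀ k (i j : Idx n), (coef n k z).1 i j ≠ 0 → IsWeight α k i j := by
  obtain ⟨y, hy⟩ : ∃ y, α y ≠ 0 := by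
    by_contra! h
    exact hα (LinearMap.ext h)
  refine ⟨?_, ?_, fun k i j h0 y => ?_⟩
  · have := congrArg (centCoef n) (hz y)
    rw [(cartanAff_lie y.2 z).2.1, map_smul, eq_comm, smul_eq_zero] at this
    exact this.resolve_left hy
  · have := congrArg (degCoef n) (hz y)
    rw [degCoef_lie, map_smul, eq_comm, smul_eq_zero] at this
    exact this.resolve_left hy
  · obtain ⟨h1, h2, h3⟩ := cartanAff_lie y.2 z
    have := congrArg (coef n k) (hz y)
    rw [h3, map_smul] at this
    have := congrFun (congrFun (congrArg Subtype.val this) i) j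
    change (⁅coef n 0 y.1, coef n k z⁆ : G n).1 i j + (degCoef n y.1 * k) * (coef n k z).1 i j =
      α y * (coef n k z).1 i j at this
    rw [cartan_lie_apply h1, ← add_mul] at this
    exact (mul_right_cancel₀ h0 this).symm

/-- Evaluation at `d` recovers the degree, and evaluation at `diag(0, c, -c)` the finite part. -/
lemma IsWeight.unique {α : Module.Dual ℂ (cartanAff n)} {k k' : ℤ} {i j i' j' : Idx n}
    (h : IsWeight α k i j) (h' : IsWeight α k' i' j') :
    k' = k ∧ ∀ c, i.wt c - j.wt c = i'.wt c - j'.wt c := by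
  constructor
  · have h1 := (h ⟨_, dElt_mem⟩).symm.trans (h' ⟨_, dElt_mem⟩)
    simp only [coef_dElt, degCoef_dElt] at h1
    have hz (m : Idx n) : m.wt (diagVec (0 : G n)) = 0 := by
      rw [← apply_self]; rfl
    simp only [hz, sub_zero, zero_add, one_mul] at h1
    exact_mod_cast h1.symm
  · intro c
    have hc := mono_mem_cartanAff (cartanElt_mem c)
    have h1 := (h ⟨_, hc⟩).symm.trans (h' ⟨_, hc⟩)
    simpa only [coef_mono, if_true, diagVec_cartanElt, degCoef_mono, zero_mul, add_zero] using h1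

lemma isWeight_rootD2 {r s : ℕ} (hrs : IsRootIndex n r s) {i j : Idx n} (hi : i.pos = r)
    (hj : j.pos = s + 1) : IsWeight (rootD2 n r s) 0 i j := by
  intro h
  -- `zeroMode n` and `coef n 0` agree by definition.
  change posRoot n r s (coef n 0 h.1) = _
  rw [posRoot_apply hrs hi hj, Int.cast_zero, mul_zero, add_zero]

lemma isWeight_rootD3 {r s : ℕ} (hrs : IsRootIndex n r s) {i j : Idx n} (hi : i.pos = r)
    (hj : j.pos = s + 1) : IsWeight (rootD3 n r s) 1 j i := by
  intro h
  change degCoef n h.1 - posRoot n r s (coef n 0 h.1) = _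
  rw [posRoot_apply hrs hi hj]
  push_cast
  ring

lemma IsWeight.dual {α : Module.Dual ℂ (cartanAff n)} {k : ℤ} {i j : Idx n}
    (h : IsWeight α k i j) : IsWeight α k j.dual i.dual := by
  intro y
  rw [h y, wt_dual, wt_dual]
  ring

lemma IsWeight.ne_zero {α : Module.Dual ℂ (cartanAff n)} {k : ℤ} {i j : Idx n}
    (h : IsWeight α k i j) (hne : k ≠ 0 ∨ i ≠ j) : α ≠ 0 := by
  rintro rfl
  have h0 : IsWeight (0 : Module.Dual ℂ (cartanAff n)) 0 i i := fun y => by simp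
  obtain ⟨h1, h2⟩ := h0.unique h
  refine hne.elim (fun h => h h1) fun h => h ?_
  exact eq_of_wt_eq fun c => by linear_combination -(h2 c)

lemma mono_rootVec_mem {α : Module.Dual ℂ (cartanAff n)} {k : ℤ} {i j : Idx n}
    (h : IsWeight α k i j) : mono n (rootVec i j) k ∈ rootSpace n α := by
  refine mem_rootSpace (centCoef_mono _ _) (degCoef_mono _ _) fun l i' j' h0 => ?_
  rw [coef_mono] at h0
  split_ifs at h0 with hl
  · subst hl
    rcases of_rootVec_apply_ne_zero h0 with ⟨rfl, rfl⟩ | ⟨rfl, rfl⟩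
    · exact h
    · exact h.dual
  · exact (h0 rfl).elim

lemma mem_nPlusAff {z : GAff n} (hc : centCoef n z = 0) (hd : degCoef n z = 0)
    (hneg : ∀ k < 0, coef n k z = 0) (h0 : coef n 0 z ∈ nPlus n) : z ∈ nPlusAff n := by
  obtain ⟨s, hs⟩ := exists_eq_sum_mono hc hd
  rw [hs]
  refine sum_mem fun k _ => Submodule.subset_span ?_
  rcases lt_trichotomy k 0 with hk | rfl | hk
  · left
    refine ⟨0, zero_mem _, ?_⟩
    rw [hneg k hk]
    refine GAff_ext (fun l => ?_) rfl rfl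
    rw [coef_mono, coef_mono, ite_self, ite_self]
  · exact Or.inl ⟨_, h0, rfl⟩
  · exact Or.inr ⟨_, k, hk, rfl⟩

/-- A weight of a position in `𝔫̃₊` off the antidiagonal is a positive root. -/
lemma IsWeight.isPositiveRoot {α : Module.Dual ℂ (cartanAff n)} {k : ℤ} {i j : Idx n}
    (h : IsWeight α k i j) (hij : j ≠ i.dual) (hk : 0 < k ∨ k = 0 ∧ i.pos < j.pos) :
    IsPositiveRoot n α := by
  have hα : α ≠ 0 := h.ne_zero (hk.imp ne_of_gt fun h h' => by rw [h'] at h; omega)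
  refine ⟨hα, fun hbot => ?_, fun z hz => ?_⟩
  · have h1 := mono_rootVec_mem h
    rw [hbot, Submodule.mem_bot] at h1
    have h2 := congrArg (coef n k) h1
    rw [coef_mono, if_pos rfl, map_zero] at h2
    exact rootVec_apply_ne_zero hij (by rw [h2]; rfl)
  · obtain ⟨hc, hd, hw⟩ := of_mem_rootSpace hα hz
    refine mem_nPlusAff hc hd (fun l hl => ?_) (mem_nPlus_of_upper fun i' j' h0 => ?_)
    · apply Subtype.ext
      ext (i' : Idx n) (j' : Idx n)
      by_contra h0
      have := (h.unique (hw l i' j' h0)).1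
      omega
    · obtain ⟨h1, h2⟩ := h.unique (hw 0 i' j' h0)
      -- All positions of one weight have the same height `j.pos - i.pos`, so one of them above the
      -- diagonal puts all of them there.
      obtain ⟨c, hc⟩ := exists_wt_eq_pos n
      have h3 := h2 c
      rw [hc, hc, hc, hc] at h3
      norm_cast at h3
      omega

lemma isPositiveRoot_rootD2 {r s : ℕ} (hrs : IsRootIndex n r s) :
    IsPositiveRoot n (rootD2 n r s) := by
  obtain ⟨i, j, hi, hj⟩ := hrs.exists_idx
  have ⟨h1, h2, h3⟩ := hrs
  exact (isWeight_rootD2 hrs hi hj).isPositiveRoot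
    (by rw [Ne, eq_dual_iff]; omega) (Or.inr ⟨rfl, by omega⟩)

lemma isPositiveRoot_rootD3 {r s : ℕ} (hrs : IsRootIndex n r s) :
    IsPositiveRoot n (rootD3 n r s) := by
  obtain ⟨i, j, hi, hj⟩ := hrs.exists_idx
  have ⟨h1, h2, h3⟩ := hrs
  exact (isWeight_rootD3 hrs hi hj).isPositiveRoot
    (by rw [Ne, eq_dual_iff]; omega) (Or.inl one_pos)

end AffineB
end

/-! ### Sufficiency, by constructing an ideal from the two paths; then necessity. -/

namespace AffineB

variable {n : ℕ}

/-! ### The ideal of a pair of paths -/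

/-- The condition on `(k, u, v)` for the matrix entry at the positions `u`, `v` of the coefficient
at `t^k` to be nonzero somewhere in the ideal of the pair of paths `(p, q)`. -/
def Supported (n : ℕ) (p q : List Letter) (k u v : ℤ) : Prop :=
  -- Above the antidiagonal, `(u, v)` is the root `(u, v - 1)`; below it, the mirror position gives
  -- `(2n + 2 - v, 2n + 1 - u)`. On it both conditions are vacuous, which is harmless as those
  -- entries vanish. In degree one the roles of `u` and `v` are exchanged.
  (k = 0 ∧ u < v ∧ (u + v ≤ 2 * n + 1 → LowerBox p u (v - 1)) ∧
    (2 * n + 3 ≤ u + v → LowerBox p (2 * n + 2 - v) (2 * n + 1 - u))) ∨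
  (k = 1 ∧ (v < u → (u + v ≤ 2 * n + 1 → UpperBox n q v (u - 1)) ∧
    (2 * n + 3 ≤ u + v → UpperBox n q (2 * n + 2 - u) (2 * n + 1 - v)))) ∨
  2 ≤ k

lemma Supported.dual {p q : List Letter} {k u v : ℤ} (h : Supported n p q k u v) :
    Supported n p q k (2 * n + 2 - v) (2 * n + 2 - u) := by
  rcases h with ⟨hk, huv, h1, h2⟩ | ⟨hk, h⟩ | hk
  · refine Or.inl ⟨hk, by omega, fun h => ?_, fun h => ?_⟩
    · exact (h2 (by omega)).mono (by omega) (by omega)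
    · exact (h1 (by omega)).mono (by omega) (by omega)
  · refine Or.inr (Or.inl ⟨hk, fun huv => ⟨fun h' => ?_, fun h' => ?_⟩⟩)
    · exact ((h (by omega)).2 (by omega)).mono (by omega) (by omega)
    · exact ((h (by omega)).1 (by omega)).mono (by omega) (by omega)
  · exact Or.inr (Or.inr hk)

/-- The conditions on the first two rows of boxes northeast of `p` and of `q` which make the roots
they determine the support of an ideal. -/
structure RowBounds (n a b : ℕ) (p q : List Letter) : Prop where
  three_le : 3 ≤ a
  lt : a < b
  le : b ≤ 2 * n
  lower_one : ∀ s, LowerBox p 1 s → (a : ℤ) - 1 ≤ s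
  lower_two : ∀ s, LowerBox p 2 s → (b : ℤ) - 2 ≤ s
  upper_one : UpperBox n q 1 (2 * n + 2 - b)
  upper_two : UpperBox n q 2 (2 * n + 1 - a)

section

variable {a b : ℕ} {p q : List Letter}

/-- A root of `D₂` in the support, plus a root of `D₃` or `δ`. -/
lemma RowBounds.supported_one (hb : RowBounds n a b p q) {u m v : ℤ} (hm1 : 1 ≤ m)
    (hu : u ≤ 2 * n + 1) (hum : u + m ≠ 2 * n + 2)
    (hmv : m + v ≠ 2 * n + 2) (h : Supported n p q 0 m v) : Supported n p q 1 u v := by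
  obtain ⟨ha3, hab, hbn, l1, l2, u1, u2⟩ := hb
  rcases h with ⟨-, hlt, h1, h2⟩ | ⟨h, -⟩ | h
  · refine Or.inr (Or.inl ⟨rfl, fun hvu => ?_⟩)
    by_cases hmv' : m + v ≤ 2 * n + 1
    · have hA := h1 hmv'
      -- In row 1, `v ≥ a ≥ 3` and, off the antidiagonal, `u ≤ 2n`; so the resulting box is in row
      -- at least 2 and `upper_two` suffices. In the other rows `v ≥ b - 1`, and `upper_one`
      -- suffices.
      by_cases hm : m = 1
      · have := l1 _ (hA.mono (by omega) le_rfl)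
        exact ⟨fun _ => u2.mono (by omega) (by omega), fun _ => u2.mono (by omega) (by omega)⟩
      · have := l2 _ (hA.mono (by omega) le_rfl)
        exact ⟨fun _ => u1.mono (by omega) (by omega), fun _ => u1.mono (by omega) (by omega)⟩
    -- The mirror row `2n + 2 - v` is at least 2 because `v < u ≤ 2n + 1`. Moreover `m < v < u` puts
    -- `(u, v)` beyond the antidiagonal as well.
    · have := l2 _ ((h2 (by omega)).mono (by omega) le_rfl)
      exact ⟨fun _ => by omega, fun _ => u1.mono (by omega) (by omega)⟩
  · omega
  · omega

/-- The addition of a root of `B_n` at the level of matrix positions. -/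
lemma Supported.add_upper {k u m v : ℤ} (h : Supported n p q k m v) (hum : u ≤ m)
    (hmv : m + v ≠ 2 * n + 2) : Supported n p q k u v := by
  rcases h with ⟨hk, hlt, h1, h2⟩ | ⟨hk, h⟩ | hk
  · refine Or.inl ⟨hk, by omega, fun h => ?_, fun h => ?_⟩
    · by_cases hmv' : m + v ≤ 2 * n + 1
      · exact (h1 hmv').mono hum le_rfl
      -- Moving up from `m` to `u` crosses the antidiagonal; the box of `(u, v)` is still northeast
      -- of the mirror box of `(m, v)`.
      · exact (h2 (by omega)).mono (by omega) (by omega)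
    · exact (h2 (by omega)).mono (by omega) (by omega)
  · refine Or.inr (Or.inl ⟨hk, fun hvu => ⟨fun h' => ?_, fun h' => ?_⟩⟩)
    · by_cases hmv' : m + v ≤ 2 * n + 1
      · exact ((h (by omega)).1 hmv').mono le_rfl (by omega)
      · exact ((h (by omega)).2 (by omega)).mono (by omega) (by omega)
    · exact ((h (by omega)).2 (by omega)).mono (by omega) (by omega)
  · exact Or.inr (Or.inr hk)

lemma Supported.nonneg {k u v : ℤ} (h : Supported n p q k u v) : 0 ≤ k := by
  rcases h with ⟨h, -⟩ | ⟨h, -⟩ | h <;> omega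

/-- Degree at least two is always supported, so only two cases have content: a factor of degree one
times an entry of degree zero, and a factor from the upper triangular part of degree zero. -/
lemma RowBounds.supported_add (hb : RowBounds n a b p q) {k l : ℤ} {i m j : Idx n}
    (him : m ≠ i.dual) (hmj : j ≠ m.dual) (hij : j ≠ i.dual)
    (hk : 0 < k ∨ k = 0 ∧ i.pos ≤ m.pos) (h : Supported n p q l m.pos j.pos) :
    Supported n p q (k + l) i.pos j.pos := by
  rw [Ne, eq_dual_iff] at him hmj hij
  have hl := h.nonneg
  rcases hk with hk | ⟨rfl, hk⟩
  · by_cases h2 : 2 ≤ k + l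
    · exact Or.inr (Or.inr h2)
    · obtain rfl : k = 1 := by omega
      obtain rfl : l = 0 := by omega
      exact hb.supported_one (one_le_pos m) (pos_le i) (by omega) (by omega) h
  · rw [zero_add]
    exact h.add_upper hk (by omega)

variable (n p q) in
/-- The span of the root vectors at the positions allowed by `Supported`. -/
def pathIdeal : Submodule ℂ (GAff n) where
  carrier := {z | centCoef n z = 0 ∧ degCoef n z = 0 ∧
    ∀ k (i j : Idx n), ¬ Supported n p q k i.pos j.pos → (coef n k z).1 i j = 0}
  add_mem' {x y} hx hy := by
    refine ⟨by rw [map_add, hx.1, hy.1, add_zero], by rw [map_add, hx.2.1, hy.2.1, add_zero],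
      fun k i j h => ?_⟩
    rw [map_add]
    change (coef n k x).1 i j + (coef n k y).1 i j = 0
    rw [hx.2.2 k i j h, hy.2.2 k i j h, add_zero]
  zero_mem' := ⟨map_zero _, map_zero _, fun k i j _ => by rw [map_zero]; rfl⟩
  smul_mem' c x hx := by
    refine ⟨by rw [map_smul, hx.1, smul_zero], by rw [map_smul, hx.2.1, smul_zero],
      fun k i j h => ?_⟩
    rw [map_smul]
    change c * (coef n k x).1 i j = 0
    rw [hx.2.2 k i j h, mul_zero]

lemma supported_of_ne_zero {z : GAff n} (hz : z ∈ pathIdeal n p q) {k : ℤ} {i j : Idx n}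
    (h : (coef n k z).1 i j ≠ 0) : Supported n p q k i.pos j.pos := by
  by_contra h'
  exact h (hz.2.2 k i j h')

lemma mem_pathIdeal {z : GAff n} (hc : centCoef n z = 0) (hd : degCoef n z = 0)
    (h : ∀ k (i j : Idx n), (coef n k z).1 i j ≠ 0 → Supported n p q k i.pos j.pos) :
    z ∈ pathIdeal n p q := by
  refine ⟨hc, hd, fun k i j h' => ?_⟩
  by_contra h0
  exact h' (h k i j h0)

lemma coef_eq_zero_of_neg {z : GAff n} (hz : z ∈ pathIdeal n p q) {k : ℤ} (hk : k < 0) :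
    coef n k z = 0 := by
  apply Subtype.ext
  ext (i : Idx n) (j : Idx n)
  by_contra h0
  have := (supported_of_ne_zero hz h0).nonneg
  omega

lemma pathIdeal_le : pathIdeal n p q ≤ nPlusAff n := by
  intro z hz
  refine mem_nPlusAff hz.1 hz.2.1 (fun k hk => coef_eq_zero_of_neg hz hk)
    (mem_nPlus_of_upper fun i j h0 => ?_)
  rcases supported_of_ne_zero hz h0 with ⟨-, h, -⟩ | ⟨h, -⟩ | h <;> omega

lemma RowBounds.mono_lie_mem (hb : RowBounds n a b p q) {x : G n} {k : ℤ}
    (hx : 0 < k ∨ k = 0 ∧ ∀ i j : Idx n, x.1 i j ≠ 0 → i.pos ≤ j.pos) {z : GAff n}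
    (hz : z ∈ pathIdeal n p q) : ⁅mono n x k, z⁆ ∈ pathIdeal n p q := by
  refine mem_pathIdeal ?_ (degCoef_lie _ _) fun l i j h0 => ?_
  · rw [centCoef_mono_lie]
    -- The central term pairs degree `k` with degree `-k` and carries the factor `k`; the ideal has
    -- no negative degrees.
    rcases hx with hk | ⟨rfl, -⟩
    · rw [coef_eq_zero_of_neg hz (by omega), map_zero, mul_zero]
    · rw [Int.cast_zero, zero_mul]
  · have hij := ne_dual_of_apply_ne_zero h0
    rw [coef_mono_lie, hz.2.1, zero_mul, zero_smul, sub_zero, lie_apply] at h0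
    obtain ⟨(m : Idx n), -, hm⟩ := Finset.exists_ne_zero_of_sum_ne_zero h0
    have key {i m j : Idx n} (hij : j ≠ i.dual) (hxm : x.1 i m ≠ 0)
        (hzm : (coef n (l - k) z).1 m j ≠ 0) : Supported n p q l i.pos j.pos := by
      have := hb.supported_add (k := k) (ne_dual_of_apply_ne_zero hxm)
        (ne_dual_of_apply_ne_zero hzm) hij (hx.imp id fun h => ⟨h.1, h.2 i m hxm⟩)
        (supported_of_ne_zero hz hzm)
      rwa [add_sub_cancel] at this
    by_cases h1 : x.1 i m * (coef n (l - k) z).1 m j = 0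
    -- The other product `z_{im} x_{mj}` becomes one of the form `x z` after reflection of both
    -- factors in the antidiagonal.
    · rw [h1, zero_sub, neg_ne_zero] at hm
      have := key (i := j.dual) (m := m.dual) (j := i.dual)
        (fun h => hij (by rw [h, dual_dual]))
        (apply_dual_ne_zero (right_ne_zero_of_mul hm))
        (apply_dual_ne_zero (left_ne_zero_of_mul hm))
      have := this.dual
      rw [pos_dual, pos_dual] at this
      simpa using this
    · exact key hij (left_ne_zero_of_mul h1) (right_ne_zero_of_mul h1)

lemma RowBounds.lie_mem (hb : RowBounds n a b p q) {x z : GAff n} (hx : x ∈ borelAff n)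
    (hz : z ∈ pathIdeal n p q) : ⁅x, z⁆ ∈ pathIdeal n p q := by
  let N : Submodule ℂ (GAff n) :=
    { carrier := {x | ⁅x, z⁆ ∈ pathIdeal n p q}
      add_mem' := fun {x y} hx hy => by
        change ⁅x + y, z⁆ ∈ pathIdeal n p q
        rw [add_lie]; exact add_mem hx hy
      zero_mem' := by
        change ⁅(0 : GAff n), z⁆ ∈ pathIdeal n p q
        rw [zero_lie]; exact zero_mem _
      smul_mem' := fun c x hx => by
        change ⁅c • x, z⁆ ∈ pathIdeal n p q
        rw [smul_lie]; exact Submodule.smul_mem _ c hx }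
  have hle : borelAff n ≤ N := by
    refine sup_le (Submodule.span_le.2 ?_) (Submodule.span_le.2 ?_)
    · rintro _ ((rfl | rfl) | ⟨h, hh, rfl⟩)
      · change ⁅cElt n, z⁆ ∈ pathIdeal n p q
        rw [cElt_lie]; exact zero_mem _
      · refine mem_pathIdeal (centCoef_dElt_lie z) (degCoef_lie _ _) fun k i j h0 => ?_
        rw [coef_dElt_lie] at h0
        exact supported_of_ne_zero hz (right_ne_zero_of_mul h0)
      · refine hb.mono_lie_mem (Or.inr ⟨rfl, fun i j h0 => ?_⟩) hz
        by_contra hij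
        exact h0 (hh fun h => hij (by rw [h]))
    · rintro _ (⟨x, hx, rfl⟩ | ⟨x, k, hk, rfl⟩)
      · exact hb.mono_lie_mem (Or.inr ⟨rfl, fun i j h0 => (upper_of_mem_nPlus hx i j h0).le⟩) hz
      · exact hb.mono_lie_mem (Or.inl hk) hz
  exact hle hx

lemma coef_eq_zero_of_mem_borelAff {z : GAff n} (hz : z ∈ borelAff n) {k : ℤ} (hk : k < 0) :
    coef n k z = 0 := by
  have hle : borelAff n ≤ LinearMap.ker (coef n k) := by
    refine sup_le (Submodule.span_le.2 ?_) (Submodule.span_le.2 ?_)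
    · rintro _ ((rfl | rfl) | ⟨h, hh, rfl⟩)
      · exact coef_cElt k
      · exact coef_dElt k
      · exact (coef_mono h 0 k).trans (if_neg (by omega))
    · rintro _ (⟨x, hx, rfl⟩ | ⟨x, l, hl, rfl⟩)
      · exact (coef_mono x 0 k).trans (if_neg (by omega))
      · exact (coef_mono x l k).trans (if_neg (by omega))
  exact hle hz

/-- An element of `𝔟̃` with no component of degree `0` or `1`, nor along `c` or `d`, has degrees at
least two only and lies in the ideal. -/
lemma finite_codim_pathIdeal :
    FiniteDimensional ℂ (↥(borelAff n) ⧸ (pathIdeal n p q).submoduleOf (borelAff n)) := by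
  let φ : borelAff n →ₗ[ℂ] (G n × G n) × (ℂ × ℂ) :=
    (((coef n 0).prod (coef n 1)).prod ((centCoef n).prod (degCoef n))).domRestrict (borelAff n)
  have hker : LinearMap.ker φ ≤ (pathIdeal n p q).submoduleOf (borelAff n) := by
    intro z hz
    have h : ((coef n 0 z.1, coef n 1 z.1), (centCoef n z.1, degCoef n z.1)) = 0 := hz
    simp only [Prod.mk_eq_zero] at h
    refine mem_pathIdeal h.2.1 h.2.2 fun k i j h0 => Or.inr (Or.inr ?_)
    by_contra hk
    have : coef n k z.1 = 0 := by
      rcases lt_trichotomy k 0 with hk' | rfl | hk'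
      · exact coef_eq_zero_of_mem_borelAff z.2 hk'
      · exact h.1.1
      · obtain rfl : k = 1 := by omega
        exact h.1.2
    exact h0 (congrFun (congrFun (congrArg Subtype.val this) i) j)
  have : FiniteDimensional ℂ (↥(borelAff n) ⧸ LinearMap.ker φ) :=
    Module.Finite.equiv φ.quotKerEquivRange.symm
  exact Module.Finite.of_surjective (Submodule.factor hker) (Submodule.factor_surjective hker)

/-- Being supported depends only on the weight: equal weights mean equal or mirror positions, or two
diagonal ones, which are never supported in degree zero and always in positive degree. -/
lemma IsWeight.supported {α : Module.Dual ℂ (cartanAff n)} {k k' : ℤ} {i j i' j' : Idx n}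
    (h : IsWeight α k i j) (h' : IsWeight α k' i' j') (hij : j ≠ i.dual)
    (hs : Supported n p q k i.pos j.pos) : Supported n p q k' i'.pos j'.pos := by
  obtain ⟨rfl, hw⟩ := h.unique h'
  rcases eq_or_dual_of_wt_sub_eq hij hw with ⟨rfl, rfl⟩ | ⟨rfl, rfl⟩ | ⟨rfl, rfl⟩
  · exact hs
  · rw [pos_dual, pos_dual]
    exact hs.dual
  · rcases hs with ⟨-, h, -⟩ | ⟨h, -⟩ | h
    · omega
    · exact Or.inr (Or.inl ⟨h, fun h => by omega⟩)
    · exact Or.inr (Or.inr h)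

lemma rootSpace_le_pathIdeal {α : Module.Dual ℂ (cartanAff n)} (hα : α ≠ 0) {k : ℤ} {i j : Idx n}
    (h : IsWeight α k i j) (hij : j ≠ i.dual) (hs : Supported n p q k i.pos j.pos) :
    rootSpace n α ≤ pathIdeal n p q := by
  intro z hz
  obtain ⟨hc, hd, hw⟩ := of_mem_rootSpace hα hz
  exact mem_pathIdeal hc hd fun k' i' j' h0 => h.supported (hw k' i' j' h0) hij hs

/-- Since support is a property of the weight, a single nonzero vector of a root space in the ideal
brings in the whole root space, including the multidimensional imaginary ones. -/
lemma RowBounds.isCombinatorialIdeal (hb : RowBounds n a b p q) :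
    IsCombinatorialIdeal n (pathIdeal n p q) where
  le_nPlus := pathIdeal_le
  lie_mem _ hx _ hz := hb.lie_mem hx hz
  finite_codim := finite_codim_pathIdeal
  rootSpaces α hα := by
    by_cases h : ∃ z ∈ pathIdeal n p q ⊓ rootSpace n α, z ≠ 0
    · right
      obtain ⟨z, ⟨hzI, hz⟩, hz0⟩ := h
      obtain ⟨hc, hd, hw⟩ := of_mem_rootSpace hα.1 hz
      obtain ⟨k, i, j, h0⟩ : ∃ k, ∃ i j : Idx n, (coef n k z).1 i j ≠ 0 := by
        by_contra! hcon
        refine hz0 (GAff_ext (fun k => ?_) (hc.trans (map_zero _).symm) (hd.trans (map_zero _).symm))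
        rw [map_zero]
        apply Subtype.ext
        ext (i : Idx n) (j : Idx n)
        exact hcon k i j
      exact rootSpace_le_pathIdeal hα.1 (hw k i j h0) (ne_dual_of_apply_ne_zero h0)
        (supported_of_ne_zero hzI h0)
    · left
      push Not at h
      exact (Submodule.eq_bot_iff _).2 h

lemma mem_supp_pathIdeal_iff {α : Module.Dual ℂ (cartanAff n)} {k : ℤ} {i j : Idx n}
    (h : IsWeight α k i j) (hij : j ≠ i.dual) (hα : IsPositiveRoot n α) :
    α ∈ supp n (pathIdeal n p q) ↔ Supported n p q k i.pos j.pos := by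
  constructor
  · rintro ⟨-, hle⟩
    refine supported_of_ne_zero (hle (mono_rootVec_mem h)) ?_
    rw [coef_mono, if_pos rfl]
    exact rootVec_apply_ne_zero hij
  · exact fun hs => ⟨hα, rootSpace_le_pathIdeal hα.1 h hij hs⟩

lemma rootD2_mem_supp_iff {r s : ℕ} (hrs : IsRootIndex n r s) :
    rootD2 n r s ∈ supp n (pathIdeal n p q) ↔ LowerBox p r s := by
  obtain ⟨i, j, hi, hj⟩ := hrs.exists_idx
  have ⟨h1, h2, h3⟩ := hrs
  rw [mem_supp_pathIdeal_iff (isWeight_rootD2 hrs hi hj) (by rw [Ne, eq_dual_iff]; omega)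
    (isPositiveRoot_rootD2 hrs), hi, hj]
  constructor
  · rintro (⟨-, -, h, -⟩ | ⟨h, -⟩ | h)
    · exact (h (by omega)).mono le_rfl (by omega)
    · omega
    · omega
  · exact fun h => Or.inl ⟨rfl, by omega, fun _ => h.mono le_rfl (by omega), fun _ => by omega⟩

lemma rootD3_mem_supp_iff {r s : ℕ} (hrs : IsRootIndex n r s) :
    rootD3 n r s ∈ supp n (pathIdeal n p q) ↔ UpperBox n q r s := by
  obtain ⟨i, j, hi, hj⟩ := hrs.exists_idx
  have ⟨h1, h2, h3⟩ := hrs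
  rw [mem_supp_pathIdeal_iff (isWeight_rootD3 hrs hi hj) (by rw [Ne, eq_dual_iff]; omega)
    (isPositiveRoot_rootD3 hrs), hi, hj]
  constructor
  · rintro (⟨h, -⟩ | ⟨-, h⟩ | h)
    · omega
    · exact ((h (by omega)).1 (by omega)).mono le_rfl (by omega)
    · omega
  · exact fun h => Or.inr (Or.inl ⟨rfl, fun _ => ⟨fun _ => h.mono le_rfl (by omega),
      fun _ => by omega⟩⟩)

lemma RowBounds.isAdmissible (hb : RowBounds n a b p q) (hp : IsBPath n p) (hq : IsBPath n q) :
    IsAdmissible n p q := by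
  have h1 := hb.three_le
  have h2 := hb.lt
  have h3 := hb.le
  -- The root `δ - (1, 2n + 2 - b)` witnesses that the support meets `D`.
  have hrs : IsRootIndex n 1 (2 * n + 2 - b) := ⟨by omega, by omega, by omega⟩
  refine ⟨pathIdeal n p q, ⟨hb.isCombinatorialIdeal, _, (rootD3_mem_supp_iff hrs).2 ?_,
    Or.inr ⟨1, _, hrs, rfl⟩⟩, hp, hq, fun r s hrs => rootD2_mem_supp_iff hrs,
    fun r s hrs => rootD3_mem_supp_iff hrs⟩
  exact hb.upper_one.mono (by simp) (by omega)

end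

/-! ### Necessity -/

lemma lie_mem_rootSpace {α β : Module.Dual ℂ (cartanAff n)} {x y : GAff n}
    (hx : x ∈ rootSpace n α) (hy : y ∈ rootSpace n β) : ⁅x, y⁆ ∈ rootSpace n (α + β) := by
  intro h
  rw [leibniz_lie, hx h, hy h, smul_lie, lie_smul, ← add_smul, LinearMap.add_apply]

/-- Only the path `i → m → j` contributes to this entry; the mirror entries of the two root vectors
do not interfere. -/
lemma lie_rootVec_apply_ne_zero {i m j : Idx n} (him : i ≠ m) (him' : m ≠ i.dual)
    (hmj : j ≠ m.dual) (hij : j ≠ i.dual) : (⁅rootVec i m, rootVec m j⁆ : G n).1 i j ≠ 0 := by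
  have h1 (k : Idx n) (hk : k ≠ m) : (rootVec i m).1 i k = 0 := by
    by_contra h0
    rcases of_rootVec_apply_ne_zero h0 with h | h
    · exact hk h.2
    · exact him' (by rw [h.1, dual_dual])
  have h2 (k : Idx n) : (rootVec m j).1 i k = 0 := by
    by_contra h0
    rcases of_rootVec_apply_ne_zero h0 with h | h
    · exact him h.1
    · exact hij (by rw [h.1, dual_dual])
  rw [lie_apply, Finset.sum_eq_single m]
  · rw [h2, zero_mul, sub_zero]
    exact mul_ne_zero (rootVec_apply_ne_zero him') (rootVec_apply_ne_zero hmj)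
  · intro k _ hk
    rw [h1 k hk, h2, zero_mul, zero_mul, sub_zero]
  · simp

/-- If `α ∈ supp I` has the position `(i, m)` and `γ` the position `(m, j)` at `t`, then
`α + γ ∈ supp I`. -/
lemma mem_supp_of_isWeight {I : Submodule ℂ (GAff n)} (hI : IsCombinatorialIdeal n I)
    {α β γ : Module.Dual ℂ (cartanAff n)} {i m j : Idx n} (hα : α ∈ supp n I)
    (hαw : IsWeight α 0 i m) (hγw : IsWeight γ 1 m j) (hβw : IsWeight β 1 i j)
    (him : i ≠ m) (him' : m ≠ i.dual) (hmj : j ≠ m.dual) (hij : j ≠ i.dual) :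
    β ∈ supp n I := by
  have hβ : IsPositiveRoot n β := hβw.isPositiveRoot hij (Or.inl one_pos)
  refine ⟨hβ, (hI.rootSpaces β hβ).resolve_left fun hbot => ?_⟩
  have hx := mono_rootVec_mem hαw
  have hy := mono_rootVec_mem hγw
  have hsum : γ + α = β := by
    ext h
    rw [LinearMap.add_apply, hαw, hβw, hγw]
    push_cast
    ring
  -- The bracket is a nonzero vector of `I` in the root space of `β`, so the alternative in
  -- `rootSpaces` forces that whole root space into `I`.
  have hmem : ⁅mono n (rootVec m j) 1, mono n (rootVec i m) 0⁆ ∈ I ⊓ rootSpace n β := by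
    refine ⟨hI.lie_mem _ ?_ _ (hα.2 hx), hsum ▸ lie_mem_rootSpace hy hx⟩
    exact Submodule.mem_sup_right (Submodule.subset_span (Or.inr ⟨_, 1, one_pos, rfl⟩))
  rw [hbot, Submodule.mem_bot, ← lie_skew, neg_eq_zero] at hmem
  have h1 := congrArg (coef n 1) hmem
  rw [coef_mono_lie, degCoef_mono, zero_mul, zero_smul, sub_zero, sub_zero, coef_mono,
    if_pos rfl, map_zero] at h1
  exact lie_rootVec_apply_ne_zero him him' hmj hij (by rw [h1]; rfl)

variable {a b : ℕ} {p q : List Letter}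

/-- This is the identity `(2, b - 2) + (δ - θ) = δ - (1, 2n + 2 - b)`, with `θ = (1, 2n - 1)`. -/
lemma IsPathPair.upperBox_one {I : Submodule ℂ (GAff n)} (hI : IsCombinatorialIdeal n I)
    (hpq : IsPathPair n I p q) (h4 : 4 ≤ b) (hb : b ≤ 2 * n) (h : LowerBox p 2 (b - 2)) :
    UpperBox n q 1 (2 * n + 2 - b) := by
  have hrs : IsRootIndex n 2 (b - 2) := ⟨by omega, by omega, by omega⟩
  have hrs' : IsRootIndex n 1 (2 * n + 2 - b) := ⟨by omega, by omega, by omega⟩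
  have htop : IsRootIndex n 1 (2 * n - 1) := ⟨by omega, by omega, by omega⟩
  have hα : rootD2 n 2 (b - 2) ∈ supp n I :=
    (hpq.left_separates _ _ hrs).2 (h.mono (by simp) (by omega))
  -- The root `(2, b - 2)` is taken at the mirror position `(2n + 3 - b, 2n)`, so that it composes
  -- with `δ - θ` at `(2n, 1)`.
  obtain ⟨i, hi⟩ := exists_pos_eq (n := n) (u := 2 * n + 3 - b) (by omega) (by omega)
  obtain ⟨m, hm⟩ := exists_pos_eq (n := n) (u := 2 * n) (by omega) (by omega)
  obtain ⟨j, hj⟩ := exists_pos_eq (n := n) (u := 1) (by omega) (by omega)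
  have h1 : IsWeight (rootD2 n 2 (b - 2)) 0 i m := by
    simpa using (isWeight_rootD2 hrs (i := m.dual) (j := i.dual)
      (by rw [pos_dual]; omega) (by rw [pos_dual]; omega)).dual
  have h2 := isWeight_rootD3 htop (i := j) (j := m) (by omega) (by omega)
  have h3 := isWeight_rootD3 hrs' (i := j) (j := i) (by omega) (by omega)
  have := (hpq.right_separates _ _ hrs').1 (mem_supp_of_isWeight hI hα h1 h2 h3
    (fun h => by rw [h] at hi; omega) (by rw [Ne, eq_dual_iff]; omega)
    (by rw [Ne, eq_dual_iff]; omega) (by rw [Ne, eq_dual_iff]; omega))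
  exact UpperBox.mono this (by simp) (by omega)

/-- This is the identity `(1, a - 1) + (δ - θ) = δ - (2, 2n + 1 - a)`; here `a ≥ 3` is needed for
`(2, 2n + 1 - a)` to be a root. -/
lemma IsPathPair.upperBox_two {I : Submodule ℂ (GAff n)} (hI : IsCombinatorialIdeal n I)
    (hpq : IsPathPair n I p q) (h3 : 3 ≤ a) (ha : a < 2 * n) (h : LowerBox p 1 (a - 1)) :
    UpperBox n q 2 (2 * n + 1 - a) := by
  have hrs : IsRootIndex n 1 (a - 1) := ⟨by omega, by omega, by omega⟩
  have hrs' : IsRootIndex n 2 (2 * n + 1 - a) := ⟨by omega, by omega, by omega⟩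
  have htop : IsRootIndex n 1 (2 * n - 1) := ⟨by omega, by omega, by omega⟩
  have hα : rootD2 n 1 (a - 1) ∈ supp n I :=
    (hpq.left_separates _ _ hrs).2 (h.mono (by simp) (by omega))
  -- Both summands are taken at mirror positions: `(2n + 2 - a, 2n + 1)` for `(1, a - 1)` and `(2n +
  -- 1, 2)` for `δ - θ`.
  obtain ⟨i, hi⟩ := exists_pos_eq (n := n) (u := 2 * n + 2 - a) (by omega) (by omega)
  obtain ⟨m, hm⟩ := exists_pos_eq (n := n) (u := 2 * n + 1) (by omega) (by omega)
  obtain ⟨j, hj⟩ := exists_pos_eq (n := n) (u := 2) (by omega) (by omega)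
  have h1 : IsWeight (rootD2 n 1 (a - 1)) 0 i m := by
    simpa using (isWeight_rootD2 hrs (i := m.dual) (j := i.dual)
      (by rw [pos_dual]; omega) (by rw [pos_dual]; omega)).dual
  have h2 : IsWeight (rootD3 n 1 (2 * n - 1)) 1 m j := by
    simpa using (isWeight_rootD3 htop (i := m.dual) (j := j.dual)
      (by rw [pos_dual]; omega) (by rw [pos_dual]; omega)).dual
  have h3 := isWeight_rootD3 hrs' (i := j) (j := i) (by omega) (by omega)
  have := (hpq.right_separates _ _ hrs').1 (mem_supp_of_isWeight hI hα h1 h2 h3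
    (fun h => by rw [h] at hi; omega) (by rw [Ne, eq_dual_iff]; omega)
    (by rw [Ne, eq_dual_iff]; omega) (by rw [Ne, eq_dual_iff]; omega))
  exact UpperBox.mono this (by simp) (by omega)

lemma isAdmissible_iff (ha : 3 ≤ a) (hab : a < b) (hb : b ≤ 2 * n) (hp : p ∈ B n a b) :
    IsAdmissible n p q ↔
      ∃ i j : ℕ, 2 * n + 4 - b ≤ i ∧ 2 * n + 4 - a ≤ j ∧ q ∈ B n i j := by
  have l1 {s : ℤ} := lowerBox_one_iff hp (by omega) (s := s)
  have l2 {s : ℤ} := lowerBox_two_iff hp (by omega) (s := s)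
  constructor
  · rintro ⟨I, ⟨hI, -⟩, hpq⟩
    obtain ⟨i, j, hq⟩ := exists_mem_B hpq.right_isBPath
    have u1 := (upperBox_one_iff hq).1 (hpq.upperBox_one hI (by omega) hb (l2.2 le_rfl))
    have u2 := (upperBox_two_iff hq).1 (hpq.upperBox_two hI ha (by omega) (l1.2 le_rfl))
    exact ⟨i, j, by omega, by omega, hq⟩
  · rintro ⟨i, j, hi, hj, hq⟩
    have hr : RowBounds n a b p q :=
      { three_le := ha
        lt := hab
        le := hb
        lower_one := fun _ => l1.1
        lower_two := fun _ => l2.1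
        upper_one := (upperBox_one_iff hq).2 (by omega)
        upper_two := (upperBox_two_iff hq).2 (by omega) }
    exact hr.isAdmissible hp.1 hq.1

end AffineB

theorem mainTheorem4 (n a b : ℕ) (ha : 3 ≤ a) (hab : a < b) (hb : b ≤ 2 * n)
    (p : List AffineB.Letter) (hp : p ∈ AffineB.B n a b) :
    (∀ q : List AffineB.Letter, AffineB.IsAdmissible n p q ↔
      ∃ i j : ℕ, 2 * n + 4 - b ≤ i ∧ 2 * n + 4 - a ≤ j ∧ q ∈ AffineB.B n i j) ∧
    {q : List AffineB.Letter | AffineB.IsAdmissible n p q}.ncard =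
      ∑ i ∈ Finset.Icc (2 * n + 4 - b) (2 * n + 2),
        ∑ j ∈ Finset.Icc (2 * n + 4 - a) (2 * n + 2), (AffineB.B n i j).ncard := by
  have h (q : List AffineB.Letter) := AffineB.isAdmissible_iff (q := q) ha hab hb hp
  refine ⟨h, ?_⟩
  rw [← AffineB.ncard_exists_mem_B]
  exact congrArg Set.ncard (Set.ext h)
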